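/- Fix an integer $T\ge 2$ and real exponents $\gamma_{\mathrm{sr}1}\ge\gamma_{\mathrm{sr}2}\ge 0$, $\gamma_{\mathrm{rd}1},\gamma_{\mathrm{rd}2}\in\mathbb{R}$, and for $\mathsf{SNR}>1$ put $\rho_l^2=\mathsf{SNR}^{\gamma_l}$ for each link $l\in\{\mathrm{sr}1,\mathrm{sr}2,\mathrm{rd}1,\mathrm{rd}2\}$. All logarithms are natural and mutual information is measured in nats. Consider the noncoherent two-relay diamond network over one fading block of length $T$: $$Y_{\mathrm{R}_i}=g_{\mathrm{sr}i}X_{\mathrm S}+W_{\mathrm{R}_i}\ (i=1,2),\qquad Y_{\mathrm D}=g_{\mathrm{rd}1}X_{\mathrm{R}_1}+g_{\mathrm{rd}2}X_{\mathrm{R}_2}+W_{\mathrm D},$$ where $X_{\mathrm S},X_{\mathrm{R}_1},X_{\mathrm{R}_2}$ are random vectors in $\mathbb{C}^T$ with an arbitrary joint law, $g_l\sim\mathcal{CN}(0,\rho_l^2)$, the vectors $W_{\mathrm{R}_1},W_{\mathrm{R}_2},W_{\mathrm D}$ have i.i.d. $\mathcal{CN}(0,1)$ entries, and the inputs $(X_{\mathrm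 S},X_{\mathrm{R}_1},X_{\mathrm{R}_2})$, the four gains and the three noise vectors are mutually independent. The cut-set bound $\bar C=\bar C(\mathsf{SNR})$ is defined by $$T\bar C=\sup\min\bigl\{I(X_{\mathrm S};Y_{\mathrm{R}_1},Y_{\mathrm{R}_2}),\ I(X_{\mathrm S};Y_{\mathrm{R}_2})+I(X_{\mathrm{R}_1};Y_{\mathrm D}\mid X_{\mathrm{R}_2}),\ I(X_{\mathrm S};Y_{\mathrm{R}_1})+I(X_{\mathrm{R}_2};Y_{\mathrm D}\mid X_{\mathrm{R}_1}),\ I(X_{\mathrm{R}_1},X_{\mathrm{R}_2};Y_{\mathrm D})\bigr\},$$ the supremum being over all joint laws of $(X_{\mathrm S},X_{\mathrm{R}_1},X_{\mathrm{R}_2})$ with $\mathbb{E}\|X_{\mathrm S}\|^2=\mathbb{E}\|X_{\mathrm{R}_1}\|^2=\mathbb{E}\|X_{\mathrm{R}_2}\|^2=T$. Let $(\mathcal P_1)=(\mathcal P_1)(\mathsf{SNR})$ be the supremum of $\min\{\psi_1,\ (T-1)\log\rho_{\mathrm{sr}2}^2+\psi_2\}$ over all joint laws of complex random variables $(x_{\mathrm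 r2},x_{\mathrm r11},x_{\mathrm r12})$ with $\mathbb{E}|x_{\mathrm r2}|^2\le T$ and $\mathbb{E}[|x_{\mathrm r11}|^2+|x_{\mathrm r12}|^2]\le T$, where, with $$D=\rho_{\mathrm{rd}2}^2|x_{\mathrm r2}|^2+\rho_{\mathrm{rd}1}^2|x_{\mathrm r11}|^2+\rho_{\mathrm{rd}1}^2|x_{\mathrm r12}|^2+\rho_{\mathrm{rd}1}^2\rho_{\mathrm{rd}2}^2|x_{\mathrm r12}|^2|x_{\mathrm r2}|^2+1,$$ $$\psi_1=T\,\mathbb{E}\log\bigl(\rho_{\mathrm{rd}2}^2|x_{\mathrm r2}|^2+\rho_{\mathrm{rd}1}^2|x_{\mathrm r11}|^2+\rho_{\mathrm{rd}1}^2|x_{\mathrm r12}|^2+T\bigr)-\mathbb{E}\log D,$$ $$\psi_2=\mathbb{E}\log\bigl(\rho_{\mathrm{rd}2}^2|x_{\mathrm r2}|^2+\rho_{\mathrm{rd}1}^2|x_{\mathrm r11}|^2+1\bigr)+(T-1)\,\mathbb{E}\log\bigl(\rho_{\mathrm{rd}1}^2|x_{\mathrm r12}|^2+T-1\bigr)-\mathbb{E}\log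 D.$$ Then $T\bar C\ \dot\le\ \min\{(T-1)\log\rho_{\mathrm{sr}1}^2,\ (\mathcal P_1)\}$ as $\mathsf{SNR}\to\infty$; that is, for every $\varepsilon>0$ and all sufficiently large $\mathsf{SNR}$, $$T\bar C\le\min\bigl\{(T-1)\log\rho_{\mathrm{sr}1}^2,\ (\mathcal P_1)\bigr\}+\varepsilon\log\mathsf{SNR}.$$ -/

import Mathlib

open MeasureTheory ProbabilityTheory Filter
open scoped ENNReal NNReal

namespace DiamondNetwork

noncomputable section

/-! ### Information measures (in nats) -/

/-- Mutual information `I(X; Y)`: the Kullback–Leibler divergence of the joint law from the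
product of the marginal laws. -/
def mutualInfo {Ω α β : Type*} [MeasurableSpace Ω] [MeasurableSpace α] [MeasurableSpace β]
    (X : Ω → α) (Y : Ω → β) (P : Measure Ω) : ℝ≥0∞ :=
  InformationTheory.klDiv (P.map fun ω => (X ω, Y ω)) ((P.map X).prod (P.map Y))

/-- Conditional mutual information `I(X; Y | Z)`: the Kullback–Leibler divergence of the joint law
of `(Z, X, Y)` from the law with the same `Z`-marginal under which `X` and `Y` have their
conditional laws given `Z` but are conditionally independent given `Z`. -/
def condMutualInfo {Ω α β γ : Type*} [MeasurableSpace Ω] [MeasurableSpace α]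
    [StandardBorelSpace α] [Nonempty α] [MeasurableSpace β] [StandardBorelSpace β] [Nonempty β]
    [MeasurableSpace γ] (X : Ω → α) (Y : Ω → β) (Z : Ω → γ) (P : Measure Ω) [IsFiniteMeasure P] :
    ℝ≥0∞ :=
  InformationTheory.klDiv (P.map fun ω => (Z ω, X ω, Y ω))
    ((P.map Z).compProd ((condDistrib X Z P).prod (condDistrib Y Z P)))

/-! ### The noncoherent two-relay diamond network, over one fading block of length `T` -/

/-- The circularly symmetric complex Gaussian law `𝒞𝒩(0, v)`: independent real and imaginary
parts, each `𝒩(0, v / 2)`. -/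
def complexGaussian (v : ℝ≥0) : Measure ℂ :=
  ((gaussianReal 0 (v / 2)).prod (gaussianReal 0 (v / 2))).map
    Complex.measurableEquivRealProd.symm

instance (v : ℝ≥0) : IsProbabilityMeasure (complexGaussian v) :=
  Measure.isProbabilityMeasure_map Complex.measurableEquivRealProd.symm.measurable.aemeasurable

/-- A block of `T` complex symbols. -/
abbrev Block (T : ℕ) : Type := Fin T → ℂ

/-- The transmitted blocks `(X_S, X_R1, X_R2)`. -/
abbrev Inputs (T : ℕ) : Type := Block T × Block T × Block T

/-- The fading gains `(g_sr1, g_sr2, g_rd1, g_rd2)`. -/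
abbrev Gains : Type := ℂ × ℂ × ℂ × ℂ

/-- The noise blocks `(W_R1, W_R2, W_D)`. -/
abbrev Noise (T : ℕ) : Type := Block T × Block T × Block T

/-- Everything that is random during one block. -/
abbrev Outcome (T : ℕ) : Type := Inputs T × Gains × Noise T

/-- The link strengths: `sr1` is `ρ_sr1²`, and so on. -/
structure LinkStrengths where
  sr1 : ℝ≥0
  sr2 : ℝ≥0
  rd1 : ℝ≥0
  rd2 : ℝ≥0

/-- The four gains are independent, `g_l ∼ 𝒞𝒩(0, ρ_l²)`. -/
def gainLaw (ρ : LinkStrengths) : Measure Gains :=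
  (complexGaussian ρ.sr1).prod
    ((complexGaussian ρ.sr2).prod ((complexGaussian ρ.rd1).prod (complexGaussian ρ.rd2)))

instance (ρ : LinkStrengths) : IsProbabilityMeasure (gainLaw ρ) := by
  unfold gainLaw; infer_instance

/-- A block of i.i.d. `𝒞𝒩(0, 1)` noise. -/
def noiseBlockLaw (T : ℕ) : Measure (Block T) :=
  Measure.pi fun _ => complexGaussian 1

instance (T : ℕ) : IsProbabilityMeasure (noiseBlockLaw T) := by
  unfold noiseBlockLaw; infer_instance

/-- The three noise blocks are independent. -/
def noiseLaw (T : ℕ) : Measure (Noise T) :=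
  (noiseBlockLaw T).prod ((noiseBlockLaw T).prod (noiseBlockLaw T))

instance (T : ℕ) : IsProbabilityMeasure (noiseLaw T) := by
  unfold noiseLaw; infer_instance

/-- The inputs have joint law `p`; inputs, gains and noise are independent. -/
def networkLaw {T : ℕ} (ρ : LinkStrengths) (p : ProbabilityMeasure (Inputs T)) :
    Measure (Outcome T) :=
  (p : Measure (Inputs T)).prod ((gainLaw ρ).prod (noiseLaw T))

instance {T : ℕ} (ρ : LinkStrengths) (p : ProbabilityMeasure (Inputs T)) :
    IsProbabilityMeasure (networkLaw ρ p) := by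
  unfold networkLaw; infer_instance

variable {T : ℕ}

/-- The block transmitted by the source. -/
def XS (ω : Outcome T) : Block T := ω.1.1

/-- The block transmitted by relay 1. -/
def XR1 (ω : Outcome T) : Block T := ω.1.2.1

/-- The block transmitted by relay 2. -/
def XR2 (ω : Outcome T) : Block T := ω.1.2.2

/-- `Y_R1 = g_sr1 X_S + W_R1`. -/
def YR1 (ω : Outcome T) : Block T :=
  match ω with
  | (x, (gsr1, _, _, _), (wR1, _, _)) => fun t => gsr1 * x.1 t + wR1 t

/-- `Y_R2 = g_sr2 X_S + W_R2`. -/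
def YR2 (ω : Outcome T) : Block T :=
  match ω with
  | (x, (_, gsr2, _, _), (_, wR2, _)) => fun t => gsr2 * x.1 t + wR2 t

/-- `Y_D = g_rd1 X_R1 + g_rd2 X_R2 + W_D`. -/
def YD (ω : Outcome T) : Block T :=
  match ω with
  | (x, (_, _, grd1, grd2), (_, _, wD)) => fun t => grd1 * x.2.1 t + grd2 * x.2.2 t + wD t

/-- `‖X‖²` of a block (Euclidean norm). -/
def energy (x : Block T) : ℝ≥0∞ := ∑ t, ‖x t‖ₑ ^ 2

/-- The average power constraint `(1/T) E‖X_S‖² = (1/T) E‖X_R1‖² = (1/T) E‖X_R2‖² = 1`. -/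
def PowerConstraint (p : ProbabilityMeasure (Inputs T)) : Prop :=
  (∫⁻ x, energy x.1 ∂(p : Measure (Inputs T))) = T ∧
  (∫⁻ x, energy x.2.1 ∂(p : Measure (Inputs T))) = T ∧
  (∫⁻ x, energy x.2.2 ∂(p : Measure (Inputs T))) = T

variable (T)

/-- The cut-set bound for one block, `T · C̄`. -/
def cutSetTC (ρ : LinkStrengths) : ℝ≥0∞ :=
  ⨆ (p : ProbabilityMeasure (Inputs T)) (_ : PowerConstraint p),
    min
      (min
        (mutualInfo XS (fun ω => (YR1 ω, YR2 ω)) (networkLaw ρ p))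
        (mutualInfo XS YR2 (networkLaw ρ p) + condMutualInfo XR1 YD XR2 (networkLaw ρ p)))
      (min
        (mutualInfo XS YR1 (networkLaw ρ p) + condMutualInfo XR2 YD XR1 (networkLaw ρ p))
        (mutualInfo (fun ω => (XR1 ω, XR2 ω)) YD (networkLaw ρ p)))

/-! ### The optimization problem `𝒫₁`

The variable is the joint law `q` of `x = (x_r2, x_r11, x_r12)`. -/

/-- The logarithm subtracted in both `ψ₁` and `ψ₂`. -/
def logDet (ρ : LinkStrengths) (x : ℂ × ℂ × ℂ) : ℝ :=
  Real.log (ρ.rd2 * ‖x.1‖ ^ 2 + ρ.rd1 * ‖x.2.1‖ ^ 2 + ρ.rd1 * ‖x.2.2‖ ^ 2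
    + ρ.rd1 * ρ.rd2 * ‖x.2.2‖ ^ 2 * ‖x.1‖ ^ 2 + 1)

/-- The functional `ψ₁`. -/
def psi1 (ρ : LinkStrengths) (q : ProbabilityMeasure (ℂ × ℂ × ℂ)) : ℝ :=
  T * (∫ x, Real.log (ρ.rd2 * ‖x.1‖ ^ 2 + ρ.rd1 * ‖x.2.1‖ ^ 2 + ρ.rd1 * ‖x.2.2‖ ^ 2 + T)
      ∂(q : Measure (ℂ × ℂ × ℂ)))
    - ∫ x, logDet ρ x ∂(q : Measure (ℂ × ℂ × ℂ))

/-- The functional `ψ₂`. -/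
def psi2 (ρ : LinkStrengths) (q : ProbabilityMeasure (ℂ × ℂ × ℂ)) : ℝ :=
  (∫ x, Real.log (ρ.rd2 * ‖x.1‖ ^ 2 + ρ.rd1 * ‖x.2.1‖ ^ 2 + 1) ∂(q : Measure (ℂ × ℂ × ℂ)))
    + ((T : ℝ) - 1) *
      (∫ x, Real.log (ρ.rd1 * ‖x.2.2‖ ^ 2 + ((T : ℝ) - 1)) ∂(q : Measure (ℂ × ℂ × ℂ)))
    - ∫ x, logDet ρ x ∂(q : Measure (ℂ × ℂ × ℂ))

/-- Feasibility for `𝒫₁`: `E|x_r2|² ≤ T` and `E[|x_r11|² + |x_r12|²] ≤ T`. Under it all the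
expectations in `ψ₁` and `ψ₂` are of integrable functions. -/
def Feasible (q : ProbabilityMeasure (ℂ × ℂ × ℂ)) : Prop :=
  (∫⁻ x, ‖x.1‖ₑ ^ 2 ∂(q : Measure (ℂ × ℂ × ℂ))) ≤ T ∧
  (∫⁻ x, (‖x.2.1‖ₑ ^ 2 + ‖x.2.2‖ₑ ^ 2) ∂(q : Measure (ℂ × ℂ × ℂ))) ≤ T

/-- The optimal value `(𝒫₁)`. -/
def valueP1 (ρ : LinkStrengths) : EReal :=
  ⨆ (q : ProbabilityMeasure (ℂ × ℂ × ℂ)) (_ : Feasible T q),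
    ((min (psi1 T ρ q) (((T : ℝ) - 1) * Real.log ρ.sr2 + psi2 T ρ q) : ℝ) : EReal)

end

/-! ### gDoF asymptotics -/

/-- The link strengths `ρ_l² = SNR ^ γ_l`, i.e. `γ_l = log ρ_l² / log SNR`. -/
noncomputable def strengthsAt (γsr1 γsr2 γrd1 γrd2 snr : ℝ) : LinkStrengths where
  sr1 := (snr ^ γsr1).toNNReal
  sr2 := (snr ^ γsr2).toNNReal
  rd1 := (snr ^ γrd1).toNNReal
  rd2 := (snr ^ γrd2).toNNReal

/-- Order inequality `f ≤̇ g`: `f(SNR) ≤ g(SNR) + o(log SNR)` from above, as `SNR → ∞`. It says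
`lim f / log SNR ≤ lim g / log SNR` when these limits exist and are finite, and is meaningful
without assuming their existence. -/
def DotLE (f g : ℝ → EReal) : Prop :=
  ∀ ε : ℝ, 0 < ε → ∀ᶠ snr in atTop, f snr ≤ g snr + ((ε * Real.log snr : ℝ) : EReal)

end DiamondNetwork

/-! The bound rests on the dual (variational) form of mutual information: replacing the true output
law by any reference measure `Q` can only increase the divergence, so `I(X;Y)` is at most the
divergence of the joint law from `P_X × Q` (`mutualInfo_le_klDiv_prod`), and likewise for
conditional information, where `Q` may depend on the conditioning variable
(`condMutualInfo_le_klDiv`). If `Q` has density `exp (-A)`, and the output given `x` has density at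
most `exp (c x)`, the divergence is at most `E c + E A + K`, with `K` a bound on the mass of `Q`
(`klDiv_channel_le`). Neither normalized references nor exact entropies are needed, since everything
is allowed an additive constant uniform in the link strengths and in the input law.

Given the inputs the output is Gaussian, and its density is at most a constant over the determinant
of its covariance (`lintegral_two_gains_noise_le`); this supplies the subtracted logarithms. The
references have polynomial tails: the isotropic `(1 + ‖y‖²)^-(T+δ)`, and one adapted to a unit
vector `u`, which treats the component along `u` and the `T - 1` orthogonal dimensions separately.
The excess `δ` makes them integrable; Jensen's inequality bounds the mean exponents.

Three of the four cuts suffice. For the broadcast cut, `Y_R1` gets the isotropic reference and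
`Y_R2` the one along `Y_R1`: both relays see the same direction, so the component of `Y_R2`
orthogonal to `Y_R1` has bounded logarithmic moment when relay 1 is the stronger
(`lintegral_log_one_add_sqNorm_perp_le`). The count `T + 1 - 1 - 1` leaves `T - 1` logarithms. For
the destination, the isotropic reference gives `ψ₁`, and the reference along `X_R2` gives `ψ₂`, both
at the joint law of the norm of `X_R2` and the components of `X_R1` along and orthogonal to it
(`relayLaw`), which is feasible for `𝒫₁`. The slack is `δ` times logarithms of link strengths plus a
constant; small `δ` and large SNR absorb it. -/

namespace DiamondNetwork

open InformationTheory

/-! ### Divergence bounds and the variational form of mutual information. -/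

section KL

/-- If `μ` is dominated by the measure with density `exp h` with respect to `ν`, then its divergence
from `ν` is at most the mean of `h`, up to the normalization of `ν`. -/
theorem klDiv_le_of_le_withDensity {α : Type*} [MeasurableSpace α] {μ ν : Measure α}
    [IsProbabilityMeasure μ] [IsFiniteMeasure ν] {h : α → ℝ}
    (hle : μ ≤ ν.withDensity fun a => ENNReal.ofReal (Real.exp (h a))) (hi : Integrable h μ) :
    ((klDiv μ ν : ℝ≥0∞) : EReal) ≤ ((∫ a, h a ∂μ + ν.real Set.univ - 1 : ℝ) : EReal) := by
  have hac : μ ≪ ν := hle.absolutelyContinuous.trans (withDensity_absolutelyContinuous _ _)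
  -- Domination of measures becomes a pointwise bound on the density `r = dμ/dν`; then `klFun r = r
  -- log r + 1 - r` is at most `r h + 1 - r`, whose integral is explicit.
  have hr : ∀ᵐ a ∂ν, μ.rnDeriv ν a ≤ ENNReal.ofReal (Real.exp (h a)) := by
    refine ae_le_of_forall_setLIntegral_le_of_sigmaFinite (Measure.measurable_rnDeriv _ _) ?_
    intro s hs _
    calc ∫⁻ a in s, μ.rnDeriv ν a ∂ν = μ s := by
          rw [← withDensity_apply _ hs, Measure.withDensity_rnDeriv_eq _ _ hac]
      _ ≤ _ := hle s
      _ = _ := withDensity_apply _ hs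
  have hInt : Integrable (fun a => (μ.rnDeriv ν a).toReal * h a) ν := by
    simpa [smul_eq_mul] using (integrable_rnDeriv_smul_iff hac).2 hi
  have hInt1 : Integrable (fun a => (μ.rnDeriv ν a).toReal) ν := Measure.integrable_toReal_rnDeriv
  have hint2 : Integrable (fun a => (μ.rnDeriv ν a).toReal * h a + 1 - (μ.rnDeriv ν a).toReal) ν :=
    (hInt.add (integrable_const 1)).sub hInt1
  have hkl : ∀ᵐ a ∂ν, klFun (μ.rnDeriv ν a).toReal
      ≤ (μ.rnDeriv ν a).toReal * h a + 1 - (μ.rnDeriv ν a).toReal := by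
    filter_upwards [hr] with a ha
    rw [klFun_apply]
    have h0 : (0 : ℝ) ≤ (μ.rnDeriv ν a).toReal := ENNReal.toReal_nonneg
    have h1 : (μ.rnDeriv ν a).toReal ≤ Real.exp (h a) :=
      ENNReal.toReal_le_of_le_ofReal (Real.exp_pos _).le ha
    rcases h0.eq_or_lt with h0 | h0
    · simp [← h0]
    · have := (Real.log_le_iff_le_exp h0).2 h1
      nlinarith
  have hnn : 0 ≤ᵐ[ν] fun a => (μ.rnDeriv ν a).toReal * h a + 1 - (μ.rnDeriv ν a).toReal := by
    filter_upwards [hkl] with a ha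
    exact (klFun_nonneg ENNReal.toReal_nonneg).trans ha
  have hval : ∫ a, ((μ.rnDeriv ν a).toReal * h a + 1 - (μ.rnDeriv ν a).toReal) ∂ν
      = ∫ a, h a ∂μ + ν.real Set.univ - 1 := by
    have hadd : Integrable (fun a => (μ.rnDeriv ν a).toReal * h a + 1) ν :=
      hInt.add (integrable_const 1)
    rw [integral_sub hadd hInt1, integral_add hInt (integrable_const 1),
      Measure.integral_toReal_rnDeriv hac]
    have := integral_rnDeriv_smul (f := h) hac
    simp only [smul_eq_mul] at this
    rw [this]
    simp
  have hfin : klDiv μ ν ≤ ENNReal.ofReal (∫ a, h a ∂μ + ν.real Set.univ - 1) := by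
    rw [klDiv_eq_lintegral_klFun_of_ac hac, ← hval, ofReal_integral_eq_lintegral_ofReal hint2 hnn]
    refine lintegral_mono_ae ?_
    filter_upwards [hkl] with a ha using ENNReal.ofReal_le_ofReal ha
  have hpos : 0 ≤ ∫ a, h a ∂μ + ν.real Set.univ - 1 := by
    rw [← hval]; exact integral_nonneg_of_ae hnn
  calc ((klDiv μ ν : ℝ≥0∞) : EReal)
      ≤ ((ENNReal.ofReal (∫ a, h a ∂μ + ν.real Set.univ - 1) : ℝ≥0∞) : EReal) := by
        exact_mod_cast hfin
    _ = _ := by rw [EReal.coe_ennreal_ofReal, max_eq_left hpos]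

/-- The mutual information is the least divergence of the joint law from `P_X × Q`. -/
theorem mutualInfo_le_klDiv_prod {Ω α β : Type*} [MeasurableSpace Ω] [MeasurableSpace α]
    [StandardBorelSpace α] [Nonempty α] [MeasurableSpace β] {P : Measure Ω}
    [IsProbabilityMeasure P] {X : Ω → α} {Y : Ω → β} (hX : Measurable X) (hY : Measurable Y)
    (Q : Measure β) [IsFiniteMeasure Q] :
    mutualInfo X Y P ≤ klDiv (P.map fun ω => (X ω, Y ω)) ((P.map X).prod Q) := by
  have : IsProbabilityMeasure (P.map X) := Measure.isProbabilityMeasure_map hX.aemeasurable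
  have : IsProbabilityMeasure (P.map Y) := Measure.isProbabilityMeasure_map hY.aemeasurable
  have hXY : Measurable fun ω => (X ω, Y ω) := hX.prodMk hY
  have hYX : Measurable fun ω => (Y ω, X ω) := hY.prodMk hX
  -- The pair is swapped because the chain rule splits off the first coordinate: changing the law of
  -- `Y` to `Q` adds exactly the divergence of `P_Y` from `Q`.
  have hj : P.map (fun ω => (Y ω, X ω)) = (P.map Y) ⊗ₘ condDistrib X Y P :=
    (compProd_map_condDistrib hX.aemeasurable).symm
  calc mutualInfo X Y P
      = klDiv ((P.map fun ω => (Y ω, X ω)).map Prod.swap)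
          (((P.map Y).prod (P.map X)).map Prod.swap) := by
        rw [Measure.prod_swap, Measure.map_map measurable_swap hYX]; rfl
    _ ≤ klDiv (P.map fun ω => (Y ω, X ω)) ((P.map Y).prod (P.map X)) :=
        klDiv_map_le _ _ measurable_swap
    _ ≤ klDiv (P.map fun ω => (Y ω, X ω)) (Q.prod (P.map X)) := by
        rw [hj, ← Measure.compProd_const, ← Measure.compProd_const,
          klDiv_compProd_eq_add _ Q]
        exact le_add_self
    _ = klDiv ((P.map fun ω => (X ω, Y ω)).map Prod.swap) (((P.map X).prod Q).map Prod.swap) := by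
        rw [Measure.prod_swap, Measure.map_map measurable_swap hXY]; rfl
    _ ≤ _ := klDiv_map_le _ _ measurable_swap

/-- The conditional mutual information is the least divergence of the joint law from the law under
which `Y` is drawn given `Z` from a measure with density `f (Z, ·)`, independently of `X`. -/
theorem condMutualInfo_le_klDiv {Ω α β γ : Type*} [MeasurableSpace Ω] [MeasurableSpace α]
    [StandardBorelSpace α] [Nonempty α] [MeasurableSpace β] [StandardBorelSpace β] [Nonempty β]
    [MeasurableSpace γ] {P : Measure Ω} [IsProbabilityMeasure P] {X : Ω → α} {Y : Ω → β} {Z : Ω → γ}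
    (hX : Measurable X) (hY : Measurable Y) (hZ : Measurable Z) (l : Measure β) [SigmaFinite l]
    {f : γ × β → ℝ≥0∞} (hf : Measurable f)
    [IsFiniteMeasure (((P.map Z).prod l).withDensity f)]
    [IsFiniteMeasure (((P.map fun ω => (Z ω, X ω)).prod l).withDensity fun a => f (a.1.1, a.2))] :
    condMutualInfo X Y Z P ≤ klDiv (P.map fun ω => ((Z ω, X ω), Y ω))
      (((P.map fun ω => (Z ω, X ω)).prod l).withDensity fun a => f (a.1.1, a.2)) := by
  have hZX : Measurable fun ω => (Z ω, X ω) := hZ.prodMk hX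
  have hZY : Measurable fun ω => (Z ω, Y ω) := hZ.prodMk hY
  have : IsProbabilityMeasure (P.map Z) := Measure.isProbabilityMeasure_map hZ.aemeasurable
  have : IsProbabilityMeasure (P.map fun ω => (Z ω, Y ω)) :=
    Measure.isProbabilityMeasure_map hZY.aemeasurable
  have : IsProbabilityMeasure (P.map fun ω => (Z ω, X ω)) :=
    Measure.isProbabilityMeasure_map hZX.aemeasurable
  have : IsProbabilityMeasure (P.map fun ω => ((Z ω, X ω), Y ω)) :=
    Measure.isProbabilityMeasure_map (hZX.prodMk hY).aemeasurable
  -- The law of `X` given `Z`, read as a kernel from `(Z, Y)` that ignores `Y`. Both reference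
  -- measures are, after reordering coordinates, a law of `(Z, Y)` composed with `η` (`h₁`, `h₂`),
  -- so the chain rule compares them.
  set η : Kernel (γ × β) α := Kernel.prodMkRight β (condDistrib X Z P) with hη
  have hj : P.map (fun ω => ((Z ω, Y ω), X ω))
      = (P.map fun ω => (Z ω, Y ω)) ⊗ₘ condDistrib X (fun ω => (Z ω, Y ω)) P :=
    (compProd_map_condDistrib hX.aemeasurable).symm
  have he₁ : Measurable fun a : (γ × α) × β => ((a.1.1, a.2), a.1.2) := by fun_prop
  have he₂ : Measurable fun a : (γ × β) × α => (a.1.1, a.2, a.1.2) := by fun_prop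
  have h₁ : (((P.map fun ω => (Z ω, X ω)).prod l).withDensity fun a => f (a.1.1, a.2)).map
      (fun a => ((a.1.1, a.2), a.1.2)) = (((P.map Z).prod l).withDensity f) ⊗ₘ η := by
    refine Measure.ext_of_lintegral _ fun F hF => ?_
    have hF' : Measurable fun a : (γ × α) × β => f (a.1.1, a.2) * F ((a.1.1, a.2), a.1.2) := by
      fun_prop
    have hFe : Measurable fun a : (γ × α) × β => F ((a.1.1, a.2), a.1.2) := hF.comp he₁
    rw [lintegral_map hF he₁, lintegral_withDensity_eq_lintegral_mul _ (by fun_prop) hFe, Measure.lintegral_compProd hF,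
      lintegral_withDensity_eq_lintegral_mul _ hf (by fun_prop)]
    simp only [Pi.mul_apply]
    rw [lintegral_prod _ hF'.aemeasurable, lintegral_prod _ (by fun_prop),
      ← compProd_map_condDistrib hX.aemeasurable,
      Measure.lintegral_compProd (hF'.lintegral_prod_right')]
    refine lintegral_congr fun z => ?_
    rw [lintegral_lintegral_swap (by fun_prop)]
    refine lintegral_congr fun y => ?_
    dsimp only
    rw [lintegral_const_mul _ (by fun_prop), hη, Kernel.lintegral_prodMkRight]
  have h₂ : ((P.map fun ω => (Z ω, Y ω)) ⊗ₘ η).map (fun a => (a.1.1, a.2, a.1.2))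
      = (P.map Z) ⊗ₘ ((condDistrib X Z P).prod (condDistrib Y Z P)) := by
    refine Measure.ext_of_lintegral _ fun F hF => ?_
    have hFe : Measurable fun a : (γ × β) × α => F (a.1.1, a.2, a.1.2) := hF.comp he₂
    rw [lintegral_map hF he₂, Measure.lintegral_compProd hFe,
      Measure.lintegral_compProd hF, ← compProd_map_condDistrib hY.aemeasurable,
      Measure.lintegral_compProd (by fun_prop)]
    refine lintegral_congr fun z => ?_
    rw [Kernel.lintegral_prod_symm _ _ _ (by fun_prop)]
    rfl
  calc condMutualInfo X Y Z P
      = klDiv ((P.map fun ω => ((Z ω, Y ω), X ω)).map fun a => (a.1.1, a.2, a.1.2))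
          (((P.map fun ω => (Z ω, Y ω)) ⊗ₘ η).map fun a => (a.1.1, a.2, a.1.2)) := by
        rw [h₂, Measure.map_map he₂ (hZY.prodMk hX)]; rfl
    _ ≤ klDiv (P.map fun ω => ((Z ω, Y ω), X ω)) ((P.map fun ω => (Z ω, Y ω)) ⊗ₘ η) := by
        rw [hj]; exact klDiv_map_le _ _ he₂
    _ ≤ klDiv (P.map fun ω => ((Z ω, Y ω), X ω)) ((((P.map Z).prod l).withDensity f) ⊗ₘ η) := by
        rw [hj, klDiv_compProd_eq_add _ (((P.map Z).prod l).withDensity f)]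
        exact le_add_self
    _ = klDiv ((P.map fun ω => ((Z ω, X ω), Y ω)).map fun a => ((a.1.1, a.2), a.1.2))
          ((((P.map fun ω => (Z ω, X ω)).prod l).withDensity fun a => f (a.1.1, a.2)).map
            fun a => ((a.1.1, a.2), a.1.2)) := by
        rw [h₁, Measure.map_map he₁ (hZX.prodMk hY)]; rfl
    _ ≤ _ := klDiv_map_le _ _ he₁

/-- Divergence of the input-output law of a channel `y = φ (x, g)` with random state `g` from the
law with density `exp (-A)`, when the conditional output laws have densities at most `exp (c x)`. -/
theorem klDiv_channel_le {𝓧 𝓖 𝓨 : Type*} [MeasurableSpace 𝓧] [MeasurableSpace 𝓖]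
    [MeasurableSpace 𝓨] {p : Measure 𝓧} [IsProbabilityMeasure p] {m : Measure 𝓖}
    [IsProbabilityMeasure m] {l : Measure 𝓨} [SigmaFinite l] {φ : 𝓧 × 𝓖 → 𝓨} (hφ : Measurable φ)
    {c B : 𝓧 → ℝ} (hc : Measurable c) (hci : Integrable c p) (hB : Integrable B p)
    (hB0 : ∀ x, 0 ≤ B x) {A : 𝓧 × 𝓨 → ℝ} (hA : Measurable A) (hA0 : ∀ a, 0 ≤ A a)
    (hdens : ∀ x, ∀ F : 𝓨 → ℝ≥0∞, Measurable F →
      ∫⁻ g, F (φ (x, g)) ∂m ≤ ENNReal.ofReal (Real.exp (c x)) * ∫⁻ y, F y ∂l)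
    (hAB : ∀ x, ∫⁻ g, ENNReal.ofReal (A (x, φ (x, g))) ∂m ≤ ENNReal.ofReal (B x))
    {K : ℝ} (hK0 : 0 ≤ K)
    (hK : ∀ x, ∫⁻ y, ENNReal.ofReal (Real.exp (-A (x, y))) ∂l ≤ ENNReal.ofReal K) :
    IsFiniteMeasure ((p.prod l).withDensity fun a => ENNReal.ofReal (Real.exp (-A a))) ∧
    ((klDiv ((p.prod m).map fun a => (a.1, φ a))
      ((p.prod l).withDensity fun a => ENNReal.ofReal (Real.exp (-A a))) : ℝ≥0∞) : EReal)
      ≤ ((∫ x, c x ∂p + ∫ x, B x ∂p + K : ℝ) : EReal) := by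
  set ν := (p.prod l).withDensity fun a => ENNReal.ofReal (Real.exp (-A a)) with hν
  have hj : Measurable fun a : 𝓧 × 𝓖 => (a.1, φ a) := by fun_prop
  set μ := (p.prod m).map fun a => (a.1, φ a) with hμ
  have : IsProbabilityMeasure μ := Measure.isProbabilityMeasure_map hj.aemeasurable
  have hνK : ν Set.univ ≤ ENNReal.ofReal K := by
    rw [hν, withDensity_apply _ .univ, Measure.restrict_univ, lintegral_prod _ (by fun_prop)]
    calc _ ≤ ∫⁻ _, ENNReal.ofReal K ∂p := lintegral_mono hK
      _ = _ := by simp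
  have hfin : IsFiniteMeasure ν := ⟨hνK.trans_lt ENNReal.ofReal_lt_top⟩
  refine ⟨hfin, ?_⟩
  -- Since `ν` carries the factor `exp (-A)`, the density `exp (c + A)` against `ν` is `exp c`
  -- against `p × l`, which is what `hdens` controls.
  have hle : μ ≤ ν.withDensity fun a => ENNReal.ofReal (Real.exp (c a.1 + A a)) := by
    refine Measure.le_iff.2 fun s hs => ?_
    have hI : Measurable (s.indicator (1 : 𝓧 × 𝓨 → ℝ≥0∞)) := measurable_one.indicator hs
    have hIj : Measurable fun a : 𝓧 × 𝓖 => s.indicator (1 : 𝓧 × 𝓨 → ℝ≥0∞) (a.1, φ a) := hI.comp hj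
    rw [hν, ← withDensity_mul _ (by fun_prop) (by fun_prop), ← lintegral_indicator_one hs,
      ← lintegral_indicator_one hs, lintegral_map hI hj,
      lintegral_withDensity_eq_lintegral_mul _ (by fun_prop) hI,
      lintegral_prod _ hIj.aemeasurable, lintegral_prod _ (by fun_prop)]
    refine lintegral_mono fun x => ?_
    refine (hdens x (fun y => s.indicator 1 (x, y))
      (hI.comp measurable_prodMk_left)).trans (le_of_eq ?_)
    rw [← lintegral_const_mul _ (by fun_prop)]
    refine lintegral_congr fun y => ?_
    simp only [Pi.mul_apply]
    rw [← ENNReal.ofReal_mul (Real.exp_pos _).le, ← Real.exp_add]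
    congr 4
    ring
  have hAm : ∫⁻ a, ENNReal.ofReal (A a) ∂μ ≤ ENNReal.ofReal (∫ x, B x ∂p) := by
    rw [hμ, lintegral_map (by fun_prop) hj, lintegral_prod _ (by fun_prop),
      ofReal_integral_eq_lintegral_ofReal hB (ae_of_all _ hB0)]
    exact lintegral_mono hAB
  have hAi : Integrable A μ := by
    refine (lintegral_ofReal_ne_top_iff_integrable hA.aestronglyMeasurable (ae_of_all _ hA0)).1 ?_
    exact (hAm.trans_lt ENNReal.ofReal_lt_top).ne
  have hfst : μ.map Prod.fst = p := by
    rw [hμ, Measure.map_map measurable_fst hj]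
    exact Measure.fst_prod
  have hc' : Integrable (fun a : 𝓧 × 𝓨 => c a.1) μ := by
    rw [← hfst] at hci
    exact (integrable_map_measure hc.aestronglyMeasurable measurable_fst.aemeasurable).1 hci
  have hcint : ∫ a, c a.1 ∂μ = ∫ x, c x ∂p := by
    conv_rhs => rw [← hfst]
    rw [integral_map measurable_fst.aemeasurable hc.aestronglyMeasurable]
  refine (klDiv_le_of_le_withDensity hle (hc'.add hAi)).trans ?_
  rw [EReal.coe_le_coe_iff, integral_add hc' hAi, hcint]
  have h1 : ∫ a, A a ∂μ ≤ ∫ x, B x ∂p := by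
    rw [integral_eq_lintegral_of_nonneg_ae (ae_of_all _ hA0) hA.aestronglyMeasurable]
    exact ENNReal.toReal_le_of_le_ofReal (integral_nonneg hB0) hAm
  have h2 : ν.real Set.univ ≤ K := ENNReal.toReal_le_of_le_ofReal hK0 hνK
  linarith

end KL

end DiamondNetwork

namespace DiamondNetwork

/-! ### Complex Gaussian laws: density bounds and second moments. -/

section Gaussian

theorem lintegral_complexGaussian {v : ℝ≥0} (hv : v ≠ 0) {F : ℂ → ℝ≥0∞} (hF : Measurable F) :
    ∫⁻ z, F z ∂(complexGaussian v)
      = ∫⁻ z, ENNReal.ofReal ((Real.pi * v)⁻¹ * Real.exp (-‖z‖ ^ 2 / v)) * F z := by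
  have hv2 : v / 2 ≠ 0 := by positivity
  have he := Complex.measurableEquivRealProd.symm.measurable
  have hFe : Measurable fun a => F (Complex.measurableEquivRealProd.symm a) := hF.comp he
  rw [complexGaussian, lintegral_map hF he, gaussianReal_of_var_ne_zero _ hv2,
    prod_withDensity (measurable_gaussianPDF _ _) (measurable_gaussianPDF _ _),
    lintegral_withDensity_eq_lintegral_mul _ (by fun_prop) hFe,
    ← (Complex.volume_preserving_equiv_real_prod.symm).lintegral_comp (by fun_prop)]
  refine lintegral_congr fun a => ?_
  have hv0 : (0 : ℝ) < v := by positivity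
  have hn : ‖Complex.measurableEquivRealProd.symm a‖ ^ 2 = a.1 ^ 2 + a.2 ^ 2 := by
    rw [← Complex.normSq_eq_norm_sq, Complex.normSq_apply]
    simp [Complex.measurableEquivRealProd_symm_apply]; ring
  simp only [Pi.mul_apply, gaussianPDF, hn]
  rw [← ENNReal.ofReal_mul (gaussianPDFReal_nonneg _ _ _)]
  congr 2
  simp only [gaussianPDFReal, NNReal.coe_div, NNReal.coe_ofNat]
  rw [mul_mul_mul_comm, ← Real.exp_add, ← mul_inv, Real.mul_self_sqrt (by positivity)]
  congr 2
  · ring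
  · field_simp; ring

/-- The factor `1/π` and the exponential are both at most `1`. Only the decay `1/v` in the variance
matters for the asymptotics. -/
theorem lintegral_complexGaussian_le {v : ℝ≥0} (hv : v ≠ 0) {F : ℂ → ℝ≥0∞} (hF : Measurable F) :
    ∫⁻ z, F z ∂(complexGaussian v) ≤ ENNReal.ofReal ((v : ℝ)⁻¹) * ∫⁻ z, F z := by
  rw [lintegral_complexGaussian hv hF, ← lintegral_const_mul _ hF]
  refine lintegral_mono fun z => ?_
  gcongr
  have hv0 : (0 : ℝ) < v := by positivity
  have h1 : Real.exp (-‖z‖ ^ 2 / v) ≤ 1 := Real.exp_le_one_iff.2 (by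
    rw [neg_div]; exact neg_nonpos.2 (by positivity))
  calc (Real.pi * v)⁻¹ * Real.exp (-‖z‖ ^ 2 / v) ≤ (1 * v : ℝ)⁻¹ * 1 := by
        gcongr
        linarith [Real.pi_gt_three]
    _ = _ := by simp

theorem lintegral_complexGaussian_one_le {F : ℂ → ℝ≥0∞} (hF : Measurable F) :
    ∫⁻ z, F z ∂(complexGaussian 1) ≤ ∫⁻ z, ENNReal.ofReal (Real.exp (-‖z‖ ^ 2)) * F z := by
  rw [lintegral_complexGaussian one_ne_zero hF]
  refine lintegral_mono fun z => ?_
  gcongr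
  simp only [NNReal.coe_one, mul_one, div_one]
  have : Real.pi⁻¹ ≤ 1 := inv_le_one_of_one_le₀ (by linarith [Real.pi_gt_three])
  nlinarith [Real.exp_pos (-‖z‖ ^ 2)]

/-- Second moment of an affine function of a centred complex Gaussian. -/
theorem lintegral_norm_add_mul_sq_complexGaussian (v : ℝ≥0) (a b : ℂ) :
    ∫⁻ z, ENNReal.ofReal (‖a + b * z‖ ^ 2) ∂(complexGaussian v)
      = ENNReal.ofReal (‖a‖ ^ 2 + ‖b‖ ^ 2 * v) := by
  have he := Complex.measurableEquivRealProd.symm.measurable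
  set γ := gaussianReal 0 (v / 2) with hγ
  set c : ℂ := (starRingEnd ℂ) a * b with hc
  have hid : Integrable (fun x : ℝ => x) γ := (memLp_id_gaussianReal 1).integrable le_rfl
  have hsq : Integrable (fun x : ℝ => x ^ 2) γ := (memLp_id_gaussianReal 2).integrable_sq
  have hmean : ∫ x, x ∂γ = 0 := integral_id_gaussianReal
  have hvar : ∫ x, x ^ 2 ∂γ = v / 2 := by
    have := variance_id_gaussianReal (μ := 0) (v := v / 2)
    rw [variance_of_integral_eq_zero (by fun_prop) (by simp)] at this
    simpa using this
  have hexp : ∀ x : ℝ × ℝ, ‖a + b * Complex.measurableEquivRealProd.symm x‖ ^ 2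
      = (‖a‖ ^ 2 + ‖b‖ ^ 2 * x.1 ^ 2 + 2 * c.re * x.1) + (‖b‖ ^ 2 * x.2 ^ 2 - 2 * c.im * x.2) := by
    intro x
    simp only [← Complex.normSq_eq_norm_sq, Complex.normSq_apply, hc,
      Complex.measurableEquivRealProd_symm_apply, Complex.add_re, Complex.mul_re, Complex.add_im,
      Complex.mul_im, Complex.conj_re, Complex.conj_im]
    ring
  have hi1 : Integrable (fun x : ℝ => ‖a‖ ^ 2 + ‖b‖ ^ 2 * x ^ 2 + 2 * c.re * x) γ :=
    ((integrable_const _).add (hsq.const_mul _)).add (hid.const_mul _)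
  have hi2 : Integrable (fun x : ℝ => ‖b‖ ^ 2 * x ^ 2 - 2 * c.im * x) γ :=
    (hsq.const_mul _).sub (hid.const_mul _)
  have hv1 : ∫ x, (‖a‖ ^ 2 + ‖b‖ ^ 2 * x ^ 2 + 2 * c.re * x) ∂γ = ‖a‖ ^ 2 + ‖b‖ ^ 2 * (v / 2) := by
    have h0 : Integrable (fun x : ℝ => ‖a‖ ^ 2 + ‖b‖ ^ 2 * x ^ 2) γ :=
      (integrable_const _).add (hsq.const_mul _)
    rw [integral_add h0 (hid.const_mul _), integral_add (integrable_const _) (hsq.const_mul _),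
      integral_const_mul, integral_const_mul, hmean, hvar]
    simp
  have hv2 : ∫ x, (‖b‖ ^ 2 * x ^ 2 - 2 * c.im * x) ∂γ = ‖b‖ ^ 2 * (v / 2) := by
    rw [integral_sub (hsq.const_mul _) (hid.const_mul _), integral_const_mul, integral_const_mul,
      hmean, hvar]
    simp
  rw [complexGaussian, lintegral_map (by fun_prop) he, ← hγ]
  simp only [hexp]
  have hi : Integrable (fun x : ℝ × ℝ => (‖a‖ ^ 2 + ‖b‖ ^ 2 * x.1 ^ 2 + 2 * c.re * x.1)
      + (‖b‖ ^ 2 * x.2 ^ 2 - 2 * c.im * x.2)) (γ.prod γ) := (hi1.comp_fst γ).add (hi2.comp_snd γ)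
  rw [← ofReal_integral_eq_lintegral_ofReal hi
    (ae_of_all _ fun x => by simp only [Pi.zero_apply]; rw [← hexp x]; positivity),
    integral_add (hi1.comp_fst γ) (hi2.comp_snd γ),
    integral_fun_fst (fun x : ℝ => ‖a‖ ^ 2 + ‖b‖ ^ 2 * x ^ 2 + 2 * c.re * x),
    integral_fun_snd (fun x : ℝ => ‖b‖ ^ 2 * x ^ 2 - 2 * c.im * x), hv1, hv2]
  congr 1
  simp
  ring

theorem piFinSuccAbove_zero_symm_apply (n : ℕ) (z : ℂ) (w : Block n) :
    (MeasurableEquiv.piFinSuccAbove (fun _ : Fin (n + 1) => ℂ) 0).symm (z, w) = Fin.cons z w := by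
  ext t
  simp [MeasurableEquiv.piFinSuccAbove]

theorem measurable_finCons (n : ℕ) :
    Measurable fun a : ℂ × Block n => (Fin.cons a.1 a.2 : Block (n + 1)) := by
  simp_rw [← piFinSuccAbove_zero_symm_apply]
  exact (MeasurableEquiv.piFinSuccAbove (fun _ : Fin (n + 1) => ℂ) 0).symm.measurable

theorem lintegral_noiseBlockLaw_succ (n : ℕ) {F : Block (n + 1) → ℝ≥0∞} (hF : Measurable F) :
    ∫⁻ w, F w ∂(noiseBlockLaw (n + 1))
      = ∫⁻ z, ∫⁻ w, F (Fin.cons z w) ∂(noiseBlockLaw n) ∂(complexGaussian 1) := by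
  have h := (measurePreserving_piFinSuccAbove (fun _ : Fin (n + 1) => complexGaussian 1) 0).symm
  rw [noiseBlockLaw, ← h.lintegral_comp hF]
  rw [lintegral_prod _ (by fun_prop)]
  simp only [piFinSuccAbove_zero_symm_apply]
  rfl

/-- The normalization `π ^ (-T)` is discarded, one coordinate at a time, by induction on the block
length; an upper bound on the density is all that is needed. -/
theorem lintegral_noiseBlockLaw_le (T : ℕ) {F : Block T → ℝ≥0∞} (hF : Measurable F) :
    ∫⁻ w, F w ∂(noiseBlockLaw T)
      ≤ ∫⁻ w, ENNReal.ofReal (Real.exp (-∑ t, ‖w t‖ ^ 2)) * F w := by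
  induction T with
  | zero =>
    have : noiseBlockLaw 0 = volume := by
      rw [noiseBlockLaw, volume_pi, Measure.pi_of_empty, Measure.pi_of_empty]
    simp [this]
  | succ n ih =>
    have h := (volume_preserving_piFinSuccAbove (fun _ : Fin (n + 1) => ℂ) 0).symm
    rw [lintegral_noiseBlockLaw_succ n hF, ← h.lintegral_comp (by fun_prop),
      Measure.volume_eq_prod, lintegral_prod _ (by fun_prop)]
    simp only [piFinSuccAbove_zero_symm_apply]
    have hm : Measurable fun z : ℂ => ∫⁻ w, F (Fin.cons z w) ∂(noiseBlockLaw n) :=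
      (hF.comp (measurable_finCons n)).lintegral_prod_right'
    refine (lintegral_complexGaussian_one_le hm).trans (lintegral_mono fun z => ?_)
    have hz : Measurable fun w : Block n => F (Fin.cons z w) :=
      (hF.comp (measurable_finCons n)).comp measurable_prodMk_left
    calc _ ≤ ENNReal.ofReal (Real.exp (-‖z‖ ^ 2)) * ∫⁻ w : Block n,
            ENNReal.ofReal (Real.exp (-∑ t, ‖w t‖ ^ 2)) * F (Fin.cons z w) := by
          exact mul_le_mul_right (ih hz) _
      _ = ∫⁻ w : Block n, ENNReal.ofReal (Real.exp (-‖z‖ ^ 2)) *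
            (ENNReal.ofReal (Real.exp (-∑ t, ‖w t‖ ^ 2)) * F (Fin.cons z w)) := by
          rw [lintegral_const_mul _ (by fun_prop)]
      _ = _ := by
          refine lintegral_congr fun w => ?_
          rw [← mul_assoc, ← ENNReal.ofReal_mul (Real.exp_pos _).le, ← Real.exp_add,
            Fin.sum_univ_succ]
          simp only [Fin.cons_zero, Fin.cons_succ]
          congr 3
          ring

/-- Second moment of an affine function of white noise. -/
theorem lintegral_norm_add_sum_sq_noiseBlockLaw (T : ℕ) (c : ℂ) (a : Fin T → ℂ) :
    ∫⁻ w, ENNReal.ofReal (‖c + ∑ t, a t * w t‖ ^ 2) ∂(noiseBlockLaw T)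
      = ENNReal.ofReal (‖c‖ ^ 2 + ∑ t, ‖a t‖ ^ 2) := by
  -- The constant varies so that it can absorb the contribution of the first coordinate.
  induction T generalizing c with
  | zero => simp
  | succ n ih =>
    rw [lintegral_noiseBlockLaw_succ n (by fun_prop)]
    simp only [Fin.sum_univ_succ, Fin.cons_zero, Fin.cons_succ, ← add_assoc]
    have : ∀ z : ℂ, ∫⁻ w, ENNReal.ofReal (‖c + a 0 * z + ∑ t : Fin n, a t.succ * w t‖ ^ 2)
        ∂(noiseBlockLaw n) = ENNReal.ofReal (‖c + a 0 * z‖ ^ 2)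
          + ENNReal.ofReal (∑ t : Fin n, ‖a t.succ‖ ^ 2) := fun z => by
      rw [ih, ENNReal.ofReal_add (by positivity) (by positivity)]
    simp only [this]
    rw [lintegral_add_right _ (by fun_prop), lintegral_norm_add_mul_sq_complexGaussian]
    rw [lintegral_const, measure_univ, mul_one, ← ENNReal.ofReal_add (by positivity) (by positivity)]
    simp

end Gaussian

end DiamondNetwork

namespace DiamondNetwork

/-! ### Hermitian geometry of blocks, written out because `Block T` carries the sup norm. -/

section Geometry

variable {T : ℕ}

/-- The squared Euclidean norm of a block, as a real number. -/
noncomputable def sqNorm (x : Block T) : ℝ := ∑ t, ‖x t‖ ^ 2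

/-- The Hermitian product of two blocks, linear in the second one. -/
noncomputable def herm (u y : Block T) : ℂ := ∑ t, (starRingEnd ℂ) (u t) * y t

/-- The component of `y` orthogonal to the unit vector `u`. -/
noncomputable def perp (u y : Block T) : Block T := y - herm u y • u

/-- The direction of `x`; an arbitrary unit vector if `x = 0`. -/
noncomputable def unitDir (x : Block T) : Block T :=
  if sqNorm x = 0 then fun t => if t.val = 0 then 1 else 0
  else ((√(sqNorm x))⁻¹ : ℂ) • x

theorem sqNorm_nonneg (x : Block T) : 0 ≤ sqNorm x := Finset.sum_nonneg fun _ _ => by positivity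

theorem sqNorm_eq_zero {x : Block T} (h : sqNorm x = 0) : x = 0 := by
  ext t
  have := (Finset.sum_eq_zero_iff_of_nonneg fun _ _ => by positivity).1 h t (Finset.mem_univ t)
  simpa using this

theorem sqNorm_smul (c : ℂ) (x : Block T) : sqNorm (c • x) = ‖c‖ ^ 2 * sqNorm x := by
  simp [sqNorm, Finset.mul_sum, mul_pow]

theorem ofReal_sqNorm (x : Block T) : ENNReal.ofReal (sqNorm x) = energy x := by
  rw [sqNorm, energy, ENNReal.ofReal_sum_of_nonneg fun _ _ => by positivity]
  refine Finset.sum_congr rfl fun t _ => ?_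
  rw [ENNReal.ofReal_pow (norm_nonneg _), ofReal_norm]

@[fun_prop]
theorem measurable_sqNorm : Measurable (sqNorm : Block T → ℝ) := by
  unfold sqNorm; fun_prop

@[fun_prop]
theorem measurable_herm {α : Type*} [MeasurableSpace α] {u y : α → Block T} (hu : Measurable u)
    (hy : Measurable y) : Measurable fun a => herm (u a) (y a) := by
  unfold herm
  refine Finset.measurable_sum _ fun t _ => ?_
  exact (Complex.continuous_conj.measurable.comp (hu.eval)).mul hy.eval

@[fun_prop]
theorem measurable_perp {α : Type*} [MeasurableSpace α] {u y : α → Block T} (hu : Measurable u)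
    (hy : Measurable y) : Measurable fun a => perp (u a) (y a) := by
  unfold perp; fun_prop

@[fun_prop]
theorem measurable_unitDir : Measurable (unitDir : Block T → Block T) := by
  unfold unitDir
  refine Measurable.ite (measurable_sqNorm (measurableSet_singleton 0)) measurable_const ?_
  fun_prop

theorem herm_add (u y z : Block T) : herm u (y + z) = herm u y + herm u z := by
  simp [herm, mul_add, Finset.sum_add_distrib]

theorem herm_smul (u : Block T) (c : ℂ) (y : Block T) : herm u (c • y) = c * herm u y := by
  simp only [herm, Pi.smul_apply, smul_eq_mul, Finset.mul_sum]
  exact Finset.sum_congr rfl fun _ _ => by ring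

theorem herm_sub (u y z : Block T) : herm u (y - z) = herm u y - herm u z := by
  simp [herm, mul_sub, Finset.sum_sub_distrib]

theorem herm_self (u : Block T) : herm u u = (sqNorm u : ℂ) := by
  simp [herm, sqNorm, Complex.conj_mul']

theorem perp_add (u y z : Block T) : perp u (y + z) = perp u y + perp u z := by
  simp only [perp, herm_add, add_smul]; abel

theorem perp_sub (u y z : Block T) : perp u (y - z) = perp u y - perp u z := by
  simp only [perp, herm_sub, sub_smul]; abel

theorem perp_smul (u : Block T) (c : ℂ) (y : Block T) : perp u (c • y) = c • perp u y := by
  simp only [perp, herm_smul, smul_sub, mul_smul]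

/-- Pythagoras: the projection along a unit vector is orthogonal to its complement, so the cross
terms vanish. -/
theorem sqNorm_eq_herm_add_perp {u : Block T} (hu : sqNorm u = 1) (y : Block T) :
    sqNorm y = ‖herm u y‖ ^ 2 + sqNorm (perp u y) := by
  have h : (sqNorm (perp u y) : ℂ) = sqNorm y - herm u y * (starRingEnd ℂ) (herm u y) := by
    rw [← herm_self, ← herm_self]
    have h1 : herm (perp u y) (perp u y)
        = herm y (perp u y) - (starRingEnd ℂ) (herm u y) * herm u (perp u y) := by
      simp only [herm, perp, Pi.sub_apply, Pi.smul_apply, smul_eq_mul, map_sub, map_mul, sub_mul,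
        Finset.sum_sub_distrib, Finset.mul_sum]
      congr 1
      exact Finset.sum_congr rfl fun _ _ => by ring
    have h2 : herm u (perp u y) = 0 := by
      rw [perp, herm_sub, herm_smul, herm_self, hu]; simp
    have h3 : herm y u = (starRingEnd ℂ) (herm u y) := by
      simp only [herm, map_sum, map_mul, Complex.conj_conj]
      exact Finset.sum_congr rfl fun _ _ => by ring
    rw [h1, h2, perp, herm_sub, herm_smul, h3]
    ring
  rw [Complex.mul_conj, Complex.normSq_eq_norm_sq] at h
  have h' : sqNorm (perp u y) = sqNorm y - ‖herm u y‖ ^ 2 := by exact_mod_cast h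
  linarith

theorem norm_herm_sq_le {u : Block T} (hu : sqNorm u = 1) (y : Block T) :
    ‖herm u y‖ ^ 2 ≤ sqNorm y := by
  rw [sqNorm_eq_herm_add_perp hu y]; linarith [sqNorm_nonneg (perp u y)]

theorem sqNorm_perp_le {u : Block T} (hu : sqNorm u = 1) (y : Block T) :
    sqNorm (perp u y) ≤ sqNorm y := by
  rw [sqNorm_eq_herm_add_perp hu y]; linarith [sq_nonneg ‖herm u y‖]

theorem sqNorm_unitDir (hT : 0 < T) (x : Block T) : sqNorm (unitDir x) = 1 := by
  unfold unitDir
  split_ifs with h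
  · obtain ⟨n, rfl⟩ := Nat.exists_eq_succ_of_ne_zero hT.ne'
    simp [sqNorm, Fin.sum_univ_succ]
  · rw [sqNorm_smul]
    have h0 : 0 < sqNorm x := lt_of_le_of_ne (sqNorm_nonneg x) (Ne.symm h)
    rw [norm_inv, Complex.norm_real, Real.norm_of_nonneg (Real.sqrt_nonneg _), inv_pow,
      Real.sq_sqrt h0.le, inv_mul_cancel₀ h]

theorem sqrt_smul_unitDir (x : Block T) : (√(sqNorm x) : ℂ) • unitDir x = x := by
  unfold unitDir
  split_ifs with h
  · rw [h, sqNorm_eq_zero h]; simp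
  · have h0 : 0 < sqNorm x := lt_of_le_of_ne (sqNorm_nonneg x) (Ne.symm h)
    rw [smul_smul, mul_inv_cancel₀, one_smul]
    exact_mod_cast (Real.sqrt_pos.2 h0).ne'

theorem herm_unitDir_self (hT : 0 < T) (x : Block T) : herm (unitDir x) x = (√(sqNorm x) : ℂ) := by
  conv_lhs => rw [← sqrt_smul_unitDir x]
  rw [herm_smul, sqrt_smul_unitDir, herm_self, sqNorm_unitDir hT]
  simp

theorem perp_unitDir_self (hT : 0 < T) (x : Block T) : perp (unitDir x) x = 0 := by
  rw [perp, herm_unitDir_self hT, sqrt_smul_unitDir, sub_self]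

theorem sqNorm_add_le (x y : Block T) : sqNorm (x + y) ≤ 2 * sqNorm x + 2 * sqNorm y := by
  simp only [sqNorm, Finset.mul_sum, ← Finset.sum_add_distrib]
  refine Finset.sum_le_sum fun t _ => ?_
  have := norm_add_le (x t) (y t)
  have h0 := norm_nonneg (x t + y t)
  simp only [Pi.add_apply]
  nlinarith [sq_nonneg (‖x t‖ - ‖y t‖)]

end Geometry

/-! ### Conditional output densities bounded by inverse covariance determinants. -/

section GaussianIntegrals

variable {T : ℕ}

/-- Multiplication by `s` is a real-linear map of the plane with determinant `‖s‖²`, and translation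
preserves volume. -/
theorem lintegral_comp_add_mul {s : ℂ} (hs : s ≠ 0) (c : ℂ) {F : ℂ → ℝ≥0∞} (hF : Measurable F) :
    ∫⁻ z, F (c + s * z) = ENNReal.ofReal ((‖s‖ ^ 2)⁻¹) * ∫⁻ z, F z := by
  have hdet : LinearMap.det (LinearMap.mul ℝ ℂ s) = ‖s‖ ^ 2 := by
    rw [← Complex.normSq_eq_norm_sq, ← Algebra.norm_complex_apply, Algebra.norm_apply]
    rfl
  have hne : LinearMap.det (LinearMap.mul ℝ ℂ s) ≠ 0 := by
    rw [hdet]; positivity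
  have hmap := Measure.map_linearMap_addHaar_eq_smul_addHaar (volume : Measure ℂ) hne
  rw [hdet, abs_of_nonneg (by positivity)] at hmap
  have hFc : Measurable fun z => F (c + z) := by fun_prop
  have hm : Measurable (LinearMap.mul ℝ ℂ s) := measurable_const_mul s
  calc ∫⁻ z, F (c + s * z) = ∫⁻ z, F (c + z) ∂(Measure.map (LinearMap.mul ℝ ℂ s) volume) := by
        rw [lintegral_map hFc hm]; rfl
    _ = _ := by
        rw [hmap, lintegral_smul_measure, lintegral_add_left_eq_self]; rfl

/-- Read off from the fact that the standard complex Gaussian has total mass one. -/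
theorem lintegral_exp_neg_norm_sq :
    ∫⁻ z : ℂ, ENNReal.ofReal (Real.exp (-‖z‖ ^ 2)) = ENNReal.ofReal Real.pi := by
  have h := lintegral_complexGaussian (one_ne_zero) (F := fun _ => 1) measurable_const
  simp only [NNReal.coe_one, mul_one, div_one, lintegral_const, measure_univ] at h
  have hpi := Real.pi_pos
  simp_rw [ENNReal.ofReal_mul (inv_nonneg.2 hpi.le)] at h
  rw [lintegral_const_mul _ (by fun_prop)] at h
  rw [← one_mul (∫⁻ z : ℂ, ENNReal.ofReal (Real.exp (-‖z‖ ^ 2))), ← ENNReal.ofReal_one,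
    ← mul_inv_cancel₀ hpi.ne', ENNReal.ofReal_mul hpi.le, mul_assoc, ← h, mul_one]

theorem lintegral_exp_neg_norm_sub_mul_sq (c : ℂ) {r : ℝ} (hr : 0 < r) :
    ∫⁻ z : ℂ, ENNReal.ofReal (Real.exp (-‖c - z * (√r : ℂ)‖ ^ 2)) = ENNReal.ofReal (Real.pi / r) := by
  have hs : (-(√r : ℂ)) ≠ 0 := by
    rw [neg_ne_zero]; exact_mod_cast (Real.sqrt_pos.2 hr).ne'
  have h := lintegral_comp_add_mul hs c
    (F := fun z => ENNReal.ofReal (Real.exp (-‖z‖ ^ 2))) (by fun_prop)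
  rw [lintegral_exp_neg_norm_sq, norm_neg, Complex.norm_real,
    Real.norm_of_nonneg (Real.sqrt_nonneg _), Real.sq_sqrt hr.le,
    ← ENNReal.ofReal_mul (by positivity)] at h
  rw [div_eq_inv_mul, ← h]
  refine lintegral_congr fun z => ?_
  congr 5
  ring

/-- Only the component along `x` depends on `g`; dropping the orthogonal part of the exponent leaves
a planar Gaussian integral. -/
theorem lintegral_exp_neg_sqNorm_sub_smul_le (hT : 0 < T) (y x : Block T) (hx : 0 < sqNorm x) :
    ∫⁻ g : ℂ, ENNReal.ofReal (Real.exp (-sqNorm (y - g • x)))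
      ≤ ENNReal.ofReal (Real.pi / sqNorm x) := by
  rw [← lintegral_exp_neg_norm_sub_mul_sq (herm (unitDir x) y) hx]
  refine lintegral_mono fun g => ENNReal.ofReal_le_ofReal (Real.exp_le_exp.2 (neg_le_neg ?_))
  have := norm_herm_sq_le (sqNorm_unitDir hT x) (y - g • x)
  rwa [herm_sub, herm_smul, herm_unitDir_self hT] at this

theorem lintegral_complexGaussian_exp_neg_sqNorm_le (hT : 0 < T) {v : ℝ≥0} (hv : v ≠ 0)
    (y x : Block T) (hx : 0 < sqNorm x) :
    ∫⁻ g : ℂ, ENNReal.ofReal (Real.exp (-sqNorm (y - g • x))) ∂(complexGaussian v)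
      ≤ ENNReal.ofReal (Real.pi / (v * sqNorm x)) := by
  refine (lintegral_complexGaussian_le hv (by fun_prop)).trans ?_
  calc _ ≤ ENNReal.ofReal ((v : ℝ)⁻¹) * ENNReal.ofReal (Real.pi / sqNorm x) := by
        gcongr; exact lintegral_exp_neg_sqNorm_sub_smul_le hT y x hx
    _ = _ := by
        rw [← ENNReal.ofReal_mul (by positivity)]
        congr 1
        field_simp

/-- The determinant of the covariance of `g₁ x₁ + g₂ x₂ + w`. -/
noncomputable def covDet (v₁ v₂ : ℝ≥0) (x₁ x₂ : Block T) : ℝ :=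
  1 + v₁ * sqNorm x₁ + v₂ * sqNorm x₂ + v₁ * v₂ * sqNorm (perp (unitDir x₂) x₁) * sqNorm x₂

theorem one_le_covDet (v₁ v₂ : ℝ≥0) (x₁ x₂ : Block T) : 1 ≤ covDet v₁ v₂ x₁ x₂ := by
  have h1 := sqNorm_nonneg x₁
  have h2 := sqNorm_nonneg x₂
  have h3 := sqNorm_nonneg (perp (unitDir x₂) x₁)
  have : 0 ≤ v₁ * sqNorm x₁ + v₂ * sqNorm x₂
    + v₁ * v₂ * sqNorm (perp (unitDir x₂) x₁) * sqNorm x₂ := by positivity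
  unfold covDet; linarith

/-- The determinant is a sum of four nonnegative terms, so one of them is at least a quarter of it;
hence the `4`. According to which, it is enough to bound the integrand by `1`, to integrate over
`g₁` alone, over `g₂` alone, or over both. No exact Gaussian density is computed. -/
theorem lintegral_two_gains_exp_neg_sqNorm_le (hT : 0 < T) {v₁ v₂ : ℝ≥0} (h₁ : v₁ ≠ 0)
    (h₂ : v₂ ≠ 0) (x₁ x₂ y : Block T) :
    ∫⁻ g₁, ∫⁻ g₂, ENNReal.ofReal (Real.exp (-sqNorm (y - g₁ • x₁ - g₂ • x₂)))
      ∂(complexGaussian v₂) ∂(complexGaussian v₁)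
      ≤ ENNReal.ofReal (4 * Real.pi ^ 2 / covDet v₁ v₂ x₁ x₂) := by
  set D := covDet v₁ v₂ x₁ x₂ with hD
  have hD1 : 1 ≤ D := one_le_covDet v₁ v₂ x₁ x₂
  have hpi := Real.pi_gt_three
  have hv₁ : (0 : ℝ) < v₁ := by positivity
  have hv₂ : (0 : ℝ) < v₂ := by positivity
  have hcases : D ≤ 4 * 1 ∨ D ≤ 4 * (v₁ * sqNorm x₁) ∨ D ≤ 4 * (v₂ * sqNorm x₂)
      ∨ D ≤ 4 * (v₁ * v₂ * sqNorm (perp (unitDir x₂) x₁) * sqNorm x₂) := by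
    by_contra! h
    obtain ⟨ha, hb, hc, hd⟩ := h
    rw [hD, covDet] at ha hb hc hd
    linarith
  have key : ∀ {M : ℝ}, D ≤ 4 * M → 0 < M ∧ Real.pi / M ≤ 4 * Real.pi ^ 2 / D
      ∧ Real.pi ^ 2 / M ≤ 4 * Real.pi ^ 2 / D := by
    intro M hM
    have hM0 : 0 < M := by linarith
    have h2 : Real.pi ^ 2 / M ≤ 4 * Real.pi ^ 2 / D := by
      rw [div_le_div_iff₀ hM0 (by linarith)]
      nlinarith [sq_nonneg Real.pi]
    refine ⟨hM0, le_trans ?_ h2, h2⟩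
    gcongr
    nlinarith
  rcases hcases with h | h | h | h
  · calc _ ≤ ∫⁻ _, ∫⁻ _, 1 ∂(complexGaussian v₂) ∂(complexGaussian v₁) := by
          refine lintegral_mono fun g₁ => lintegral_mono fun g₂ => ?_
          exact ENNReal.ofReal_le_one.2 (Real.exp_le_one_iff.2 (neg_nonpos.2 (sqNorm_nonneg _)))
      _ = 1 := by simp
      _ ≤ _ := by
          rw [← ENNReal.ofReal_one]
          refine ENNReal.ofReal_le_ofReal (le_trans ?_ (key h).2.2)
          nlinarith
  · obtain ⟨hM0, hM, -⟩ := key h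
    have hx : 0 < sqNorm x₁ := by
      by_contra hc; push Not at hc; nlinarith
    rw [lintegral_lintegral_swap (by fun_prop)]
    calc _ ≤ ∫⁻ _, ENNReal.ofReal (Real.pi / (v₁ * sqNorm x₁)) ∂(complexGaussian v₂) := by
          refine lintegral_mono fun g₂ => ?_
          simp_rw [sub_right_comm y]
          exact lintegral_complexGaussian_exp_neg_sqNorm_le hT h₁ _ _ hx
      _ ≤ _ := by simpa using ENNReal.ofReal_le_ofReal hM
  · obtain ⟨hM0, hM, -⟩ := key h
    have hx : 0 < sqNorm x₂ := by
      by_contra hc; push Not at hc; nlinarith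
    calc _ ≤ ∫⁻ _, ENNReal.ofReal (Real.pi / (v₂ * sqNorm x₂)) ∂(complexGaussian v₁) := by
          refine lintegral_mono fun g₁ => ?_
          exact lintegral_complexGaussian_exp_neg_sqNorm_le hT h₂ _ _ hx
      _ ≤ _ := by simpa using ENNReal.ofReal_le_ofReal hM
  · obtain ⟨hM0, -, hM⟩ := key h
    have hx : 0 < sqNorm x₂ := by
      refine lt_of_le_of_ne (sqNorm_nonneg _) fun hc => ?_
      rw [← hc, mul_zero] at hM0; exact hM0.ne rfl
    have hp : 0 < sqNorm (perp (unitDir x₂) x₁) := by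
      refine lt_of_le_of_ne (sqNorm_nonneg _) fun hc => ?_
      rw [← hc, mul_zero, zero_mul] at hM0; exact hM0.ne rfl
    set u := unitDir x₂ with hu
    -- Along `x₂` and orthogonally to it the exponent splits, and `g₂` enters only the first
    -- summand. Integrating over `g₂` first therefore gives a bound free of `g₁`.
    have hsplit : ∀ g₁ g₂ : ℂ, sqNorm (y - g₁ • x₁ - g₂ • x₂)
        = sqNorm (perp u y - g₁ • perp u x₁)
          + ‖herm u (y - g₁ • x₁) - g₂ * (√(sqNorm x₂) : ℂ)‖ ^ 2 := fun g₁ g₂ => by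
      rw [sqNorm_eq_herm_add_perp (sqNorm_unitDir hT x₂), ← hu, herm_sub, herm_smul, perp_sub,
        perp_smul, perp_unitDir_self hT, perp_sub, perp_smul, herm_unitDir_self hT, smul_zero,
        sub_zero, add_comm]
    calc _ ≤ ∫⁻ g₁, ENNReal.ofReal (Real.exp (-sqNorm (perp u y - g₁ • perp u x₁))) *
            ENNReal.ofReal (Real.pi / (v₂ * sqNorm x₂)) ∂(complexGaussian v₁) := by
          refine lintegral_mono fun g₁ => ?_
          refine (lintegral_complexGaussian_le h₂ (by fun_prop)).trans (le_of_eq ?_)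
          simp_rw [hsplit, neg_add, Real.exp_add, ENNReal.ofReal_mul (Real.exp_pos _).le]
          rw [lintegral_const_mul _ (by fun_prop), lintegral_exp_neg_norm_sub_mul_sq _ hx,
            mul_left_comm, ← ENNReal.ofReal_mul (by positivity)]
          congr 2
          field_simp
      _ ≤ ENNReal.ofReal (Real.pi / (v₁ * sqNorm (perp u x₁)))
            * ENNReal.ofReal (Real.pi / (v₂ * sqNorm x₂)) := by
          rw [lintegral_mul_const _ (by fun_prop)]
          gcongr
          exact lintegral_complexGaussian_exp_neg_sqNorm_le hT h₁ _ _ hp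
      _ = ENNReal.ofReal (Real.pi ^ 2 / (v₁ * v₂ * sqNorm (perp u x₁) * sqNorm x₂)) := by
          rw [← ENNReal.ofReal_mul (by positivity)]
          congr 1
          field_simp
      _ ≤ _ := ENNReal.ofReal_le_ofReal hM

/-- Translating the noise integral by `h g` and exchanging the order of integration shows that the
output density at `y` is at most the mean of `exp (-‖y - h g‖²)` over `g`. -/
theorem lintegral_add_noise_le {𝓖 : Type*} [MeasurableSpace 𝓖] {m : Measure 𝓖} [SFinite m]
    {h : 𝓖 → Block T} (hh : Measurable h) {C : ℝ≥0∞}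
    (hC : ∀ y, ∫⁻ g, ENNReal.ofReal (Real.exp (-sqNorm (y - h g))) ∂m ≤ C)
    {F : Block T → ℝ≥0∞} (hF : Measurable F) :
    ∫⁻ g, ∫⁻ w, F (h g + w) ∂(noiseBlockLaw T) ∂m ≤ C * ∫⁻ y, F y := by
  have hE : Measurable fun a : 𝓖 × Block T =>
      ENNReal.ofReal (Real.exp (-sqNorm (a.2 - h a.1))) * F a.2 := by fun_prop
  calc _ ≤ ∫⁻ g, ∫⁻ y, ENNReal.ofReal (Real.exp (-sqNorm (y - h g))) * F y ∂volume ∂m := by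
        refine lintegral_mono fun g => ?_
        refine (lintegral_noiseBlockLaw_le T (by fun_prop)).trans (le_of_eq ?_)
        rw [← lintegral_add_left_eq_self (fun y => ENNReal.ofReal (Real.exp (-sqNorm (y - h g)))
          * F y) (h g)]
        simp only [add_sub_cancel_left, sqNorm]
    _ = ∫⁻ y, ∫⁻ g, ENNReal.ofReal (Real.exp (-sqNorm (y - h g))) * F y ∂m :=
        lintegral_lintegral_swap hE.aemeasurable
    _ ≤ ∫⁻ y, C * F y := by
        refine lintegral_mono fun y => ?_
        dsimp only
        rw [lintegral_mul_const _ (by fun_prop)]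
        exact mul_le_mul_left (hC y) _
    _ = _ := lintegral_const_mul _ hF

/-- Given the inputs, the output of the two-input channel has a density bounded by the inverse of
the determinant of its covariance. -/
theorem lintegral_two_gains_noise_le (hT : 0 < T) {v₁ v₂ : ℝ≥0} (h₁ : v₁ ≠ 0) (h₂ : v₂ ≠ 0)
    (x₁ x₂ : Block T) {F : Block T → ℝ≥0∞} (hF : Measurable F) :
    ∫⁻ g, ∫⁻ w, F (g.1 • x₁ + g.2 • x₂ + w) ∂(noiseBlockLaw T)
      ∂((complexGaussian v₁).prod (complexGaussian v₂))
      ≤ ENNReal.ofReal (4 * Real.pi ^ 2 / covDet v₁ v₂ x₁ x₂) * ∫⁻ y, F y := by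
  refine lintegral_add_noise_le (h := fun g : ℂ × ℂ => g.1 • x₁ + g.2 • x₂) (by fun_prop) ?_ hF
  intro y
  rw [lintegral_prod _ (by fun_prop)]
  simp_rw [← sub_sub]
  exact lintegral_two_gains_exp_neg_sqNorm_le hT h₁ h₂ x₁ x₂ y

/-- Given the input, the output of the single-input channel has a density bounded by the inverse of
the determinant of its covariance. -/
theorem lintegral_gain_noise_le (hT : 0 < T) {v : ℝ≥0} (hv : v ≠ 0) (x : Block T)
    {F : Block T → ℝ≥0∞} (hF : Measurable F) :
    ∫⁻ g, ∫⁻ w, F (g • x + w) ∂(noiseBlockLaw T) ∂(complexGaussian v)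
      ≤ ENNReal.ofReal (4 * Real.pi ^ 2 / (1 + v * sqNorm x)) * ∫⁻ y, F y := by
  refine lintegral_add_noise_le (by fun_prop) ?_ hF
  intro y
  -- A second gain of unit variance multiplies the zero block, so the determinant collapses to `1 +
  -- v ‖x‖²`.
  have h := lintegral_two_gains_exp_neg_sqNorm_le hT hv one_ne_zero x 0 y
  have h0 : sqNorm (0 : Block T) = 0 := by simp [sqNorm]
  simpa [covDet, h0] using h

end GaussianIntegrals

end DiamondNetwork

namespace DiamondNetwork

/-! ### Mean energies of the outputs and of their components. -/

section Moments

variable {T : ℕ}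

/-- The Hermitian product with `a` is linear in independent centred variables, so variances add.
Standard basis vectors `a` give the total energy, a unit direction gives the parallel component. -/
theorem lintegral_norm_herm_sq_two_gains (v₁ v₂ : ℝ≥0) (x₁ x₂ a : Block T) :
    ∫⁻ s, ENNReal.ofReal (‖herm a (s.1.1 • x₁ + s.1.2 • x₂ + s.2)‖ ^ 2)
      ∂(((complexGaussian v₁).prod (complexGaussian v₂)).prod (noiseBlockLaw T))
      = ENNReal.ofReal (v₁ * ‖herm a x₁‖ ^ 2 + v₂ * ‖herm a x₂‖ ^ 2 + sqNorm a) := by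
  have hw : ∀ g : ℂ × ℂ, ∫⁻ w, ENNReal.ofReal (‖herm a (g.1 • x₁ + g.2 • x₂ + w)‖ ^ 2)
      ∂(noiseBlockLaw T) = ENNReal.ofReal (‖g.1 * herm a x₁ + herm a x₂ * g.2‖ ^ 2)
        + ENNReal.ofReal (sqNorm a) := fun g => by
    rw [← ENNReal.ofReal_add (by positivity) (sqNorm_nonneg a)]
    have := lintegral_norm_add_sum_sq_noiseBlockLaw T (g.1 * herm a x₁ + herm a x₂ * g.2)
      fun t => (starRingEnd ℂ) (a t)
    simp only [RCLike.norm_conj] at this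
    rw [sqNorm, ← this]
    simp only [herm_add, herm_smul, mul_comm g.2]
    rfl
  rw [lintegral_prod _ (by fun_prop)]
  simp only [hw]
  rw [lintegral_add_right _ (by fun_prop), lintegral_prod _ (by fun_prop)]
  simp only [lintegral_norm_add_mul_sq_complexGaussian]
  have hg : ∀ g : ℂ, ENNReal.ofReal (‖g * herm a x₁‖ ^ 2 + ‖herm a x₂‖ ^ 2 * v₂)
      = ENNReal.ofReal (‖0 + herm a x₁ * g‖ ^ 2) + ENNReal.ofReal (‖herm a x₂‖ ^ 2 * v₂) :=
    fun g => by
      rw [ENNReal.ofReal_add (by positivity) (by positivity), zero_add, mul_comm g]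
  simp only [hg]
  rw [lintegral_add_right _ (by fun_prop), lintegral_norm_add_mul_sq_complexGaussian,
    lintegral_const, lintegral_const, measure_univ, measure_univ, mul_one, mul_one,
    ← ENNReal.ofReal_add (by positivity) (by positivity),
    ← ENNReal.ofReal_add (by positivity) (sqNorm_nonneg a)]
  congr 1
  simp
  ring

theorem lintegral_sqNorm_two_gains (v₁ v₂ : ℝ≥0) (x₁ x₂ : Block T) :
    ∫⁻ s, ENNReal.ofReal (sqNorm (s.1.1 • x₁ + s.1.2 • x₂ + s.2))
      ∂(((complexGaussian v₁).prod (complexGaussian v₂)).prod (noiseBlockLaw T))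
      = ENNReal.ofReal (v₁ * sqNorm x₁ + v₂ * sqNorm x₂ + T) := by
  have hs : ∀ (t : Fin T) (y : Block T), herm (Pi.single t 1) y = y t := fun t y => by
    simp [herm, Pi.single_apply, apply_ite (starRingEnd ℂ)]
  have h1 : ∀ t : Fin T, sqNorm (Pi.single t 1 : Block T) = 1 := fun t => by
    have := hs t (Pi.single t 1)
    rw [herm_self, Pi.single_eq_same] at this
    exact_mod_cast this
  have h := fun t : Fin T => lintegral_norm_herm_sq_two_gains v₁ v₂ x₁ x₂ (Pi.single t 1)
  simp only [hs, h1] at h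
  simp only [sqNorm]
  simp_rw [ENNReal.ofReal_sum_of_nonneg (fun _ _ => sq_nonneg _)]
  rw [lintegral_finsetSum _ (by fun_prop)]
  simp only [h]
  rw [← ENNReal.ofReal_sum_of_nonneg (fun _ _ => by positivity)]
  congr 1
  simp [Finset.sum_add_distrib, Finset.mul_sum]

/-- Total energy minus the energy along `u`; the noise keeps `T - 1` dimensions. -/
theorem lintegral_sqNorm_perp_two_gains (v₁ v₂ : ℝ≥0) (x₁ x₂ : Block T) {u : Block T}
    (hu : sqNorm u = 1) :
    ∫⁻ s, ENNReal.ofReal (sqNorm (perp u (s.1.1 • x₁ + s.1.2 • x₂ + s.2)))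
      ∂(((complexGaussian v₁).prod (complexGaussian v₂)).prod (noiseBlockLaw T))
      = ENNReal.ofReal (v₁ * sqNorm (perp u x₁) + v₂ * sqNorm (perp u x₂) + ((T : ℝ) - 1)) := by
  have h1 := lintegral_norm_herm_sq_two_gains v₁ v₂ x₁ x₂ u
  have h2 := lintegral_sqNorm_two_gains v₁ v₂ x₁ x₂
  simp_rw [sqNorm_eq_herm_add_perp hu (_ + _),
    ENNReal.ofReal_add (sq_nonneg _) (sqNorm_nonneg _)] at h2
  rw [lintegral_add_left (by fun_prop), h1, hu] at h2
  refine (ENNReal.add_right_inj (ENNReal.ofReal_ne_top (r := _))).1 (h2.trans ?_)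
  have hT : (1 : ℝ) ≤ T := by
    rcases Nat.eq_zero_or_pos T with rfl | h
    · simp [sqNorm] at hu
    · exact_mod_cast h
  have := sqNorm_nonneg (perp u x₁)
  have := sqNorm_nonneg (perp u x₂)
  rw [← ENNReal.ofReal_add (by positivity) (by
    have : 0 ≤ (T : ℝ) - 1 := by linarith
    positivity)]
  congr 1
  rw [sqNorm_eq_herm_add_perp hu x₁, sqNorm_eq_herm_add_perp hu x₂]
  ring

theorem lintegral_sqNorm_gain (v : ℝ≥0) (x : Block T) :
    ∫⁻ s, ENNReal.ofReal (sqNorm (s.1 • x + s.2)) ∂((complexGaussian v).prod (noiseBlockLaw T))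
      = ENNReal.ofReal (v * sqNorm x + T) := by
  have h := lintegral_sqNorm_two_gains v 1 x (0 : Block T)
  rw [lintegral_prod _ (by fun_prop), lintegral_prod _ (by fun_prop)] at h
  rw [lintegral_prod _ (by fun_prop)]
  simpa [sqNorm] using h

theorem lintegral_sqNorm_noise :
    ∫⁻ w, ENNReal.ofReal (sqNorm w) ∂(noiseBlockLaw T) = ENNReal.ofReal T := by
  have h := lintegral_sqNorm_gain 1 (0 : Block T)
  rw [lintegral_prod _ (by fun_prop)] at h
  simpa [sqNorm] using h

end Moments

/-! ### Jensen's inequality for the logarithm. -/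

section Jensen

variable {α : Type*} [MeasurableSpace α] {m : Measure α} [IsProbabilityMeasure m] {U : α → ℝ}

theorem lintegral_log_one_add_le (hU : Measurable U) (hU0 : ∀ a, 0 ≤ U a) {c : ℝ} (hc : 0 ≤ c)
    (h : ∫⁻ a, ENNReal.ofReal (U a) ∂m ≤ ENNReal.ofReal c) :
    ∫⁻ a, ENNReal.ofReal (Real.log (1 + U a)) ∂m ≤ ENNReal.ofReal (Real.log (1 + c)) := by
  have hc1 : 0 < 1 + c := by linarith
  -- Jensen comes from the tangent line at `c`. Its intercept is nonnegative, which lets the bound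
  -- be split inside `ℝ≥0∞` without assuming integrability.
  have hk : 0 ≤ Real.log (1 + c) - c / (1 + c) := by
    have := Real.one_sub_inv_le_log_of_pos hc1
    have h2 : c / (1 + c) = 1 - (1 + c)⁻¹ := by field_simp; ring
    rw [h2]; linarith
  have hpt : ∀ a, Real.log (1 + U a)
      ≤ (Real.log (1 + c) - c / (1 + c)) + (1 + c)⁻¹ * U a := fun a => by
    have hpos : 0 < 1 + U a := by linarith [hU0 a]
    have h1 := Real.log_le_sub_one_of_pos (div_pos hpos hc1)
    rw [Real.log_div hpos.ne' hc1.ne'] at h1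
    have h2 : (1 + U a) / (1 + c) - 1 = (1 + c)⁻¹ * U a - c / (1 + c) := by field_simp; ring
    linarith
  calc _ ≤ ∫⁻ a, (ENNReal.ofReal (Real.log (1 + c) - c / (1 + c))
          + ENNReal.ofReal ((1 + c)⁻¹) * ENNReal.ofReal (U a)) ∂m := by
        refine lintegral_mono fun a => ?_
        rw [← ENNReal.ofReal_mul (by positivity),
          ← ENNReal.ofReal_add hk (mul_nonneg (by positivity) (hU0 a))]
        exact ENNReal.ofReal_le_ofReal (hpt a)
    _ ≤ ENNReal.ofReal (Real.log (1 + c) - c / (1 + c))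
          + ENNReal.ofReal ((1 + c)⁻¹) * ENNReal.ofReal c := by
        rw [lintegral_add_right _ (by fun_prop), lintegral_const, measure_univ, mul_one,
          lintegral_const_mul _ (by fun_prop)]
        gcongr
    _ = _ := by
        rw [← ENNReal.ofReal_mul (by positivity), ← ENNReal.ofReal_add hk (by positivity)]
        congr 1
        field_simp; ring

theorem integrable_log_one_add (hU : Measurable U) (hU0 : ∀ a, 0 ≤ U a) {c : ℝ} (hc : 0 ≤ c)
    (h : ∫⁻ a, ENNReal.ofReal (U a) ∂m ≤ ENNReal.ofReal c) :
    Integrable (fun a => Real.log (1 + U a)) m := by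
  refine (lintegral_ofReal_ne_top_iff_integrable
    (Measurable.aestronglyMeasurable (by fun_prop)) (ae_of_all _ fun a => ?_)).1 ?_
  · exact Real.log_nonneg (by linarith [hU0 a])
  · exact ((lintegral_log_one_add_le hU hU0 hc h).trans_lt ENNReal.ofReal_lt_top).ne

theorem integral_log_one_add_le (hU : Measurable U) (hU0 : ∀ a, 0 ≤ U a) {c : ℝ} (hc : 0 ≤ c)
    (h : ∫⁻ a, ENNReal.ofReal (U a) ∂m ≤ ENNReal.ofReal c) :
    ∫ a, Real.log (1 + U a) ∂m ≤ Real.log (1 + c) := by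
  rw [integral_eq_lintegral_of_nonneg_ae
    (ae_of_all _ fun a => Real.log_nonneg (by linarith [hU0 a]))
    (Measurable.aestronglyMeasurable (by fun_prop))]
  exact ENNReal.toReal_le_of_le_ofReal (Real.log_nonneg (by linarith))
    (lintegral_log_one_add_le hU hU0 hc h)

end Jensen

/-! ### Reference densities with polynomial tails. -/

section ReferenceDensities

variable {T : ℕ}

/-- The integrand decays like `‖y‖` to the power `-2(n + δ)`, which beats the real dimension `2n`
precisely because `δ > 0`. -/
theorem exists_lintegral_exp_neg_log_le {E : Type*} [NormedAddCommGroup E] [NormedSpace ℝ E]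
    [FiniteDimensional ℝ E] [MeasureSpace E] [BorelSpace E]
    [(volume : Measure E).IsAddHaarMeasure] {n : ℕ} (hn : Module.finrank ℝ E = 2 * n) {δ : ℝ}
    (hδ : 0 < δ) :
    ∃ K : ℝ, 0 ≤ K ∧
      ∫⁻ y : E, ENNReal.ofReal (Real.exp (-((n + δ) * Real.log (1 + ‖y‖ ^ 2))))
        ≤ ENNReal.ofReal K := by
  have h := integrable_rpow_neg_one_add_norm_sq (E := E) (μ := volume) (r := 2 * (n + δ)) (by
    rw [hn]; push_cast; linarith)
  have heq : ∀ y : E, Real.exp (-((n + δ) * Real.log (1 + ‖y‖ ^ 2)))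
      = (1 + ‖y‖ ^ 2) ^ (-(2 * (n + δ)) / 2) := fun y => by
    rw [Real.rpow_def_of_pos (by positivity)]
    congr 1; ring
  simp_rw [heq]
  refine ⟨∫ y : E, (1 + ‖y‖ ^ 2) ^ (-(2 * (n + δ)) / 2), integral_nonneg fun y => by positivity, ?_⟩
  rw [ofReal_integral_eq_lintegral_ofReal h (ae_of_all _ fun y => by positivity)]

theorem norm_sq_le_sqNorm (y : Block T) : ‖y‖ ^ 2 ≤ sqNorm y := by
  have h : ‖y‖ ≤ √(sqNorm y) := by
    rw [pi_norm_le_iff_of_nonneg (Real.sqrt_nonneg _)]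
    intro t
    refine Real.le_sqrt_of_sq_le ?_
    exact Finset.single_le_sum (f := fun t => ‖y t‖ ^ 2) (fun _ _ => by positivity)
      (Finset.mem_univ t)
  calc ‖y‖ ^ 2 ≤ √(sqNorm y) ^ 2 := by gcongr
    _ = _ := Real.sq_sqrt (sqNorm_nonneg y)

theorem finrank_block (n : ℕ) : Module.finrank ℝ (Block n) = 2 * n := by
  simp [Module.finrank_pi_fintype, Complex.finrank_real_complex, mul_comm]

/-- The exponent of the isotropic reference density. -/
noncomputable def isoExponent (δ : ℝ) (y : Block T) : ℝ := (T + δ) * Real.log (1 + sqNorm y)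

/-- The exponent of the reference density adapted to the direction `u`. -/
noncomputable def dirExponent (δ : ℝ) (u y : Block T) : ℝ :=
  (1 + δ) * Real.log (1 + ‖herm u y‖ ^ 2) + ((T : ℝ) - 1 + δ) * Real.log (1 + sqNorm (perp u y))

@[fun_prop]
theorem measurable_isoExponent (δ : ℝ) : Measurable (isoExponent δ : Block T → ℝ) := by
  unfold isoExponent; fun_prop

@[fun_prop]
theorem measurable_dirExponent (δ : ℝ) {α : Type*} [MeasurableSpace α] {u y : α → Block T}
    (hu : Measurable u) (hy : Measurable y) : Measurable fun a => dirExponent δ (u a) (y a) := by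
  unfold dirExponent; fun_prop

theorem isoExponent_nonneg {δ : ℝ} (hδ : 0 < δ) (y : Block T) : 0 ≤ isoExponent δ y :=
  mul_nonneg (by positivity) (Real.log_nonneg (by linarith [sqNorm_nonneg y]))

theorem dirExponent_nonneg (hT : 0 < T) {δ : ℝ} (hδ : 0 < δ) (u y : Block T) :
    0 ≤ dirExponent δ u y := by
  have h1 : (1 : ℝ) ≤ T := by exact_mod_cast hT
  refine add_nonneg (mul_nonneg (by positivity) (Real.log_nonneg ?_))
    (mul_nonneg (by linarith) (Real.log_nonneg ?_))
  · linarith [sq_nonneg ‖herm u y‖]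
  · linarith [sqNorm_nonneg (perp u y)]

theorem exists_lintegral_isoExponent_le (T : ℕ) {δ : ℝ} (hδ : 0 < δ) :
    ∃ K : ℝ, 0 ≤ K ∧
      ∫⁻ y : Block T, ENNReal.ofReal (Real.exp (-isoExponent δ y)) ≤ ENNReal.ofReal K := by
  obtain ⟨K, hK0, hK⟩ := exists_lintegral_exp_neg_log_le (finrank_block T) hδ
  refine ⟨K, hK0, le_trans (lintegral_mono fun y => ?_) hK⟩
  refine ENNReal.ofReal_le_ofReal (Real.exp_le_exp.2 (neg_le_neg ?_))
  unfold isoExponent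
  gcongr
  exact norm_sq_le_sqNorm y

/-- What matters is uniformity in `u`. Instead of a unitary change of basis, one coordinate `y i`
with `‖u i‖² ≥ 1/T` is traded for the Hermitian product with `u`, at a Jacobian cost of at most `T`;
the remaining coordinates of the orthogonal part are translates of those of `y`. -/
theorem exists_lintegral_dirExponent_le (hT : 0 < T) {δ : ℝ} (hδ : 0 < δ) :
    ∃ K : ℝ, 0 ≤ K ∧ ∀ u : Block T, sqNorm u = 1 →
      ∫⁻ y : Block T, ENNReal.ofReal (Real.exp (-dirExponent δ u y)) ≤ ENNReal.ofReal K := by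
  obtain ⟨n, rfl⟩ := Nat.exists_eq_succ_of_ne_zero hT.ne'
  obtain ⟨K₁, hK₁0, hK₁⟩ := exists_lintegral_exp_neg_log_le (E := ℂ) (n := 1)
    (by simp [Complex.finrank_real_complex]) hδ
  obtain ⟨K₂, hK₂0, hK₂⟩ := exists_lintegral_exp_neg_log_le (finrank_block n) hδ
  refine ⟨(n + 1) * (K₁ * K₂), by positivity, fun u hu => ?_⟩
  obtain ⟨i, hi⟩ : ∃ i, 1 ≤ (n + 1) * ‖u i‖ ^ 2 := by
    by_contra! h
    have h1 : ∑ i, ((n : ℝ) + 1) * ‖u i‖ ^ 2 < ∑ _i : Fin (n + 1), (1 : ℝ) :=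
      Finset.sum_lt_sum_of_nonempty Finset.univ_nonempty fun i _ => h i
    rw [← Finset.mul_sum] at h1
    change (n + 1) * sqNorm u < _ at h1
    simp [hu] at h1
  have hui : u i ≠ 0 := fun h => by simp [h] at hi; linarith
  set s : ℂ := (starRingEnd ℂ) (u i) with hs
  have hs0 : s ≠ 0 := by simpa [hs] using hui
  set u' : Block n := fun j => u (i.succAbove j) with hu'
  set e₁ : ℂ → ℝ≥0∞ := fun z =>
    ENNReal.ofReal (Real.exp (-(((1 : ℕ) + δ) * Real.log (1 + ‖z‖ ^ 2)))) with he₁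
  set e₂ : Block n → ℝ≥0∞ := fun w =>
    ENNReal.ofReal (Real.exp (-((n + δ) * Real.log (1 + ‖w‖ ^ 2)))) with he₂
  have hm₁ : Measurable e₁ := by fun_prop
  have hm₂ : Measurable e₂ := by fun_prop
  -- The `i`-th coordinate of the orthogonal part is dropped, leaving `n = T - 1` complex
  -- dimensions, which match the exponent `T - 1 + δ`.
  have hpt : ∀ (z : ℂ) (w : Block n),
      ENNReal.ofReal (Real.exp (-dirExponent δ u (i.insertNth z w : Block (n + 1))))
        ≤ e₁ (herm u' w + s * z) * e₂ (w - (herm u' w + s * z) • u') := fun z w => by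
    have hh : herm u (i.insertNth z w : Block (n + 1)) = herm u' w + s * z := by
      simp only [herm, Fin.sum_univ_succAbove _ i, Fin.insertNth_apply_same,
        Fin.insertNth_apply_succAbove]
      rw [add_comm]
    have hp : ‖w - (herm u' w + s * z) • u'‖ ^ 2
        ≤ sqNorm (perp u (i.insertNth z w : Block (n + 1))) := by
      refine (norm_sq_le_sqNorm _).trans ?_
      simp only [sqNorm, perp, hh]
      rw [Fin.sum_univ_succAbove (n := n) _ i]
      simp only [Pi.sub_apply, Pi.smul_apply, Fin.insertNth_apply_succAbove, hu']
      linarith [sq_nonneg ‖(i.insertNth z w : Block (n + 1)) i - (herm u' w + s * z) • u i‖]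
    rw [he₁, he₂, ← ENNReal.ofReal_mul (Real.exp_pos _).le, ← Real.exp_add, dirExponent, hh]
    refine ENNReal.ofReal_le_ofReal (Real.exp_le_exp.2 ?_)
    have hlog : Real.log (1 + ‖w - (herm u' w + s * z) • u'‖ ^ 2)
        ≤ Real.log (1 + sqNorm (perp u (i.insertNth z w : Block (n + 1)))) := by gcongr
    have hnδ : (0 : ℝ) ≤ n + δ := by positivity
    push_cast
    nlinarith [mul_le_mul_of_nonneg_left hlog hnδ]
  have hmp := (volume_preserving_piFinSuccAbove (fun _ : Fin (n + 1) => ℂ) i).symm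
  have hmeas : Measurable fun y : Block (n + 1) => ENNReal.ofReal (Real.exp (-dirExponent δ u y)) := by
    fun_prop
  rw [← hmp.lintegral_comp hmeas, Measure.volume_eq_prod, lintegral_prod_symm _ (by fun_prop)]
  calc _ ≤ ∫⁻ w : Block n, ∫⁻ z : ℂ, e₁ (herm u' w + s * z)
            * e₂ (w - (herm u' w + s * z) • u') :=
        lintegral_mono fun w => lintegral_mono fun z => hpt z w
    _ = ∫⁻ w : Block n, ENNReal.ofReal ((‖s‖ ^ 2)⁻¹) * ∫⁻ z : ℂ, e₁ z * e₂ (w - z • u') := by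
        refine lintegral_congr fun w => ?_
        exact lintegral_comp_add_mul hs0 (herm u' w) (F := fun z => e₁ z * e₂ (w - z • u'))
          (by fun_prop)
    _ = ENNReal.ofReal ((‖s‖ ^ 2)⁻¹) * ∫⁻ z : ℂ, ∫⁻ w : Block n, e₁ z * e₂ (w - z • u') := by
        have hm : Measurable fun a : Block n × ℂ => e₁ a.2 * e₂ (a.1 - a.2 • u') := by fun_prop
        rw [lintegral_const_mul _ hm.lintegral_prod_right', lintegral_lintegral_swap hm.aemeasurable]
    _ = ENNReal.ofReal ((‖s‖ ^ 2)⁻¹) * ((∫⁻ z : ℂ, e₁ z) * ∫⁻ w : Block n, e₂ w) := by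
        congr 1
        rw [← lintegral_mul_const _ hm₁]
        refine lintegral_congr fun z => ?_
        rw [lintegral_const_mul _ (by fun_prop), lintegral_sub_right_eq_self]
    _ ≤ ENNReal.ofReal (n + 1) * (ENNReal.ofReal K₁ * ENNReal.ofReal K₂) := by
        gcongr
        rw [hs, RCLike.norm_conj]
        rw [inv_le_iff_one_le_mul₀ (by positivity)]
        exact hi
    _ = _ := by
        rw [← ENNReal.ofReal_mul hK₁0, ← ENNReal.ofReal_mul (by positivity)]

end ReferenceDensities

/-! ### Logarithmic moment of an inverse gain. -/

section LogMoment

/-- The logarithmic moment of a normalized inverse gain is finite, uniformly in the variance. -/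
theorem exists_lintegral_log_one_add_div_le :
    ∃ L : ℝ, 0 ≤ L ∧ ∀ v : ℝ≥0, v ≠ 0 →
      ∫⁻ g, ENNReal.ofReal (Real.log (1 + v / ‖g‖ ^ 2)) ∂(complexGaussian v)
        ≤ ENNReal.ofReal L := by
  set H : ℂ → ℝ≥0∞ := (Metric.ball (0 : ℂ) 1).indicator fun z =>
    ENNReal.ofReal (Real.log (1 + 1 / ‖z‖ ^ 2)) with hH
  have hHm : Measurable H := Measurable.indicator (by fun_prop) Metric.isOpen_ball.measurableSet
  -- In polar coordinates the Jacobian tames the singularity: `r log (1 + 1/r²) ≤ 2 r log (1 + 1/r)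
  -- ≤ 2`.
  have hfin : ∫⁻ z, H z < ∞ := by
    rw [← Complex.lintegral_comp_polarCoord_symm]
    calc _ ≤ ∫⁻ p in polarCoord.target, (Set.Ioo (0 : ℝ) 1 ×ˢ Set.Ioo (-Real.pi) Real.pi).indicator
            (fun _ => (2 : ℝ≥0∞)) p := by
          refine setLIntegral_mono' polarCoord.open_target.measurableSet fun p hp => ?_
          rw [polarCoord_target] at hp
          have hp1 : 0 < p.1 := hp.1
          have hn : ‖Complex.polarCoord.symm p‖ = p.1 := by
            rw [Complex.norm_polarCoord_symm, abs_of_pos hp1]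
          by_cases hlt : p.1 < 1
          · have hmem : p ∈ Set.Ioo (0 : ℝ) 1 ×ˢ Set.Ioo (-Real.pi) Real.pi := ⟨⟨hp1, hlt⟩, hp.2⟩
            rw [Set.indicator_of_mem hmem, hH,
              Set.indicator_of_mem (by rw [mem_ball_zero_iff, hn]; exact hlt), hn, smul_eq_mul,
              ← ENNReal.ofReal_mul hp1.le]
            rw [← ENNReal.ofReal_ofNat]
            refine ENNReal.ofReal_le_ofReal ?_
            have h1 : Real.log (1 + 1 / p.1 ^ 2) ≤ 2 * Real.log (1 + 1 / p.1) := by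
              rw [← Real.log_rpow (by positivity)]
              refine Real.log_le_log (by positivity) ?_
              have : 0 < 1 / p.1 := by positivity
              norm_cast
              rw [one_div, one_div, ← inv_pow]
              have : 0 < p.1⁻¹ := by positivity
              nlinarith
            have h2 := Real.log_le_sub_one_of_pos (show 0 < 1 + 1 / p.1 by positivity)
            calc p.1 * Real.log (1 + 1 / p.1 ^ 2) ≤ p.1 * (2 * (1 / p.1)) := by
                  gcongr; linarith
              _ = 2 := by field_simp
          · rw [hH, Set.indicator_of_notMem (by rw [mem_ball_zero_iff, hn]; exact hlt)]
            simp
      _ ≤ ∫⁻ p, (Set.Ioo (0 : ℝ) 1 ×ˢ Set.Ioo (-Real.pi) Real.pi).indicator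
            (fun _ => (2 : ℝ≥0∞)) p := setLIntegral_le_lintegral _ _
      _ < ∞ := by
          rw [lintegral_indicator_const (measurableSet_Ioo.prod measurableSet_Ioo),
            Measure.volume_eq_prod, Measure.prod_prod, Real.volume_Ioo, Real.volume_Ioo]
          exact ENNReal.mul_lt_top (by simp)
            (ENNReal.mul_lt_top ENNReal.ofReal_lt_top ENNReal.ofReal_lt_top)
  refine ⟨1 + (∫⁻ z, H z).toReal, by positivity, fun v hv => ?_⟩
  have hv0 : (0 : ℝ) < v := by positivity
  set r : ℝ := √v with hr
  have hr0 : 0 < r := Real.sqrt_pos.2 hv0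
  have hr2 : r ^ 2 = v := Real.sq_sqrt hv0.le
  -- After rescaling by `√v`, the logarithm is at most `1` outside the unit disc and equals `H`
  -- inside. The Jacobian `v` of the rescaling later cancels the density bound `1/v`, so the result
  -- does not depend on `v`.
  have hpt : ∀ g : ℂ, ENNReal.ofReal (Real.log (1 + v / ‖g‖ ^ 2))
      ≤ 1 + H (0 + (r⁻¹ : ℂ) * g) := fun g => by
    have hn : ‖0 + (r⁻¹ : ℂ) * g‖ = ‖g‖ / r := by
      rw [zero_add, norm_mul, norm_inv, Complex.norm_real, Real.norm_of_nonneg hr0.le]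
      field_simp
    by_cases hlt : ‖g‖ / r < 1
    · rw [hH, Set.indicator_of_mem (by rw [mem_ball_zero_iff, hn]; exact hlt), hn]
      refine le_trans (le_of_eq ?_) le_add_self
      rw [div_pow, one_div_div, hr2]
    · refine le_trans ?_ le_self_add
      rw [← ENNReal.ofReal_one]
      refine ENNReal.ofReal_le_ofReal ?_
      push Not at hlt
      rw [one_le_div hr0] at hlt
      have hg0 : 0 < ‖g‖ := hr0.trans_le hlt
      have h1 : (v : ℝ) / ‖g‖ ^ 2 ≤ 1 := by
        rw [div_le_one (by positivity), ← hr2]; gcongr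
      have h2 := Real.log_le_sub_one_of_pos (show 0 < 1 + (v : ℝ) / ‖g‖ ^ 2 by positivity)
      linarith
  calc _ ≤ ∫⁻ g, (1 + H (0 + (r⁻¹ : ℂ) * g)) ∂(complexGaussian v) := lintegral_mono hpt
    _ = 1 + ∫⁻ g, H (0 + (r⁻¹ : ℂ) * g) ∂(complexGaussian v) := by
        rw [lintegral_add_left measurable_const]; simp
    _ ≤ 1 + ENNReal.ofReal ((v : ℝ)⁻¹) * ∫⁻ g, H (0 + (r⁻¹ : ℂ) * g) := by
        gcongr; exact lintegral_complexGaussian_le hv (by fun_prop)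
    _ = 1 + ∫⁻ z, H z := by
        rw [lintegral_comp_add_mul (inv_ne_zero (by exact_mod_cast hr0.ne')) 0 hHm, ← mul_assoc,
          ← ENNReal.ofReal_mul (by positivity), norm_inv, Complex.norm_real,
          Real.norm_of_nonneg hr0.le, inv_pow, inv_inv, hr2, inv_mul_cancel₀ hv0.ne',
          ENNReal.ofReal_one, one_mul]
    _ = _ := by
        rw [ENNReal.ofReal_add zero_le_one (by positivity), ENNReal.ofReal_one,
          ENNReal.ofReal_toReal hfin.ne]

end LogMoment

end DiamondNetwork

namespace DiamondNetwork

open InformationTheory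

/-! ### Information bounds for a channel with independent random state. -/

section ChannelInformation

variable {Ω α β γ 𝓖 : Type*} [MeasurableSpace Ω] [MeasurableSpace α] [StandardBorelSpace α]
  [Nonempty α] [MeasurableSpace β] [MeasurableSpace γ] [MeasurableSpace 𝓖] {P : Measure Ω}
  [IsProbabilityMeasure P] {m : Measure 𝓖} [IsProbabilityMeasure m] {l : Measure β} [SigmaFinite l]

theorem mutualInfo_channel_le {X : Ω → α} {Y : Ω → β} (hX : Measurable X) (hY : Measurable Y)
    {φ : α × 𝓖 → β} (hφ : Measurable φ)
    (hlaw : P.map (fun ω => (X ω, Y ω)) = ((P.map X).prod m).map fun a => (a.1, φ a))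
    {c B : α → ℝ} (hc : Measurable c) (hci : Integrable c (P.map X)) (hB : Integrable B (P.map X))
    (hB0 : ∀ x, 0 ≤ B x) {A : β → ℝ} (hA : Measurable A) (hA0 : ∀ a, 0 ≤ A a)
    (hdens : ∀ x, ∀ F : β → ℝ≥0∞, Measurable F →
      ∫⁻ g, F (φ (x, g)) ∂m ≤ ENNReal.ofReal (Real.exp (c x)) * ∫⁻ y, F y ∂l)
    (hAB : ∀ x, ∫⁻ g, ENNReal.ofReal (A (φ (x, g))) ∂m ≤ ENNReal.ofReal (B x))
    {K : ℝ} (hK0 : 0 ≤ K) (hK : ∫⁻ y, ENNReal.ofReal (Real.exp (-A y)) ∂l ≤ ENNReal.ofReal K) :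
    (mutualInfo X Y P : EReal)
      ≤ ((∫ x, c x ∂(P.map X) + ∫ x, B x ∂(P.map X) + K : ℝ) : EReal) := by
  have : IsProbabilityMeasure (P.map X) := Measure.isProbabilityMeasure_map hX.aemeasurable
  set Q := l.withDensity fun y => ENNReal.ofReal (Real.exp (-A y)) with hQ
  have : IsFiniteMeasure Q := ⟨by
    rw [hQ, withDensity_apply _ .univ, Measure.restrict_univ]
    exact hK.trans_lt ENNReal.ofReal_lt_top⟩
  have h1 : (mutualInfo X Y P : EReal)
      ≤ (klDiv (P.map fun ω => (X ω, Y ω)) ((P.map X).prod Q) : ℝ≥0∞) := by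
    exact_mod_cast mutualInfo_le_klDiv_prod hX hY Q
  refine h1.trans ?_
  rw [hlaw, hQ, prod_withDensity_right (by fun_prop)]
  exact (klDiv_channel_le hφ hc hci hB hB0 (A := fun a => A a.2) (by fun_prop) (fun a => hA0 a.2)
    hdens hAB hK0 fun _ => hK).2

/-- Here the reference exponent may depend on the conditioning variable, so that it can be aligned
with the known block; `K` must then be uniform in `z`. -/
theorem condMutualInfo_channel_le [StandardBorelSpace β] [Nonempty β] {X : Ω → α} {Y : Ω → β}
    {Z : Ω → γ} (hX : Measurable X) (hY : Measurable Y) (hZ : Measurable Z)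
    {φ : (γ × α) × 𝓖 → β} (hφ : Measurable φ)
    (hlaw : P.map (fun ω => ((Z ω, X ω), Y ω))
      = ((P.map fun ω => (Z ω, X ω)).prod m).map fun a => (a.1, φ a))
    {c B : γ × α → ℝ} (hc : Measurable c) (hci : Integrable c (P.map fun ω => (Z ω, X ω)))
    (hB : Integrable B (P.map fun ω => (Z ω, X ω))) (hB0 : ∀ x, 0 ≤ B x) {A : γ × β → ℝ}
    (hA : Measurable A) (hA0 : ∀ a, 0 ≤ A a)
    (hdens : ∀ x, ∀ F : β → ℝ≥0∞, Measurable F →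
      ∫⁻ g, F (φ (x, g)) ∂m ≤ ENNReal.ofReal (Real.exp (c x)) * ∫⁻ y, F y ∂l)
    (hAB : ∀ x, ∫⁻ g, ENNReal.ofReal (A (x.1, φ (x, g))) ∂m ≤ ENNReal.ofReal (B x))
    {K : ℝ} (hK0 : 0 ≤ K)
    (hK : ∀ z, ∫⁻ y, ENNReal.ofReal (Real.exp (-A (z, y))) ∂l ≤ ENNReal.ofReal K) :
    (condMutualInfo X Y Z P : EReal)
      ≤ ((∫ x, c x ∂(P.map fun ω => (Z ω, X ω)) + ∫ x, B x ∂(P.map fun ω => (Z ω, X ω)) + K : ℝ)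
        : EReal) := by
  have : IsProbabilityMeasure (P.map fun ω => (Z ω, X ω)) :=
    Measure.isProbabilityMeasure_map (hZ.prodMk hX).aemeasurable
  have : IsProbabilityMeasure (P.map Z) := Measure.isProbabilityMeasure_map hZ.aemeasurable
  have hf : Measurable fun a : γ × β => ENNReal.ofReal (Real.exp (-A a)) := by fun_prop
  obtain ⟨hfin, hle⟩ := klDiv_channel_le hφ hc hci hB hB0 (A := fun a => A (a.1.1, a.2))
    (by fun_prop) (fun a => hA0 _) hdens hAB hK0 fun x => hK x.1
  have : IsFiniteMeasure (((P.map Z).prod l).withDensity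
      fun a => ENNReal.ofReal (Real.exp (-A a))) := ⟨by
    rw [withDensity_apply _ .univ, Measure.restrict_univ, lintegral_prod _ (by fun_prop)]
    calc _ ≤ ∫⁻ _, ENNReal.ofReal K ∂(P.map Z) := lintegral_mono hK
      _ < ∞ := by simp⟩
  have h1 : (condMutualInfo X Y Z P : EReal)
      ≤ (klDiv (P.map fun ω => ((Z ω, X ω), Y ω)) (((P.map fun ω => (Z ω, X ω)).prod l).withDensity
        fun a => ENNReal.ofReal (Real.exp (-A (a.1.1, a.2)))) : ℝ≥0∞) := by
    exact_mod_cast condMutualInfo_le_klDiv hX hY hZ l hf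
  refine h1.trans ?_
  rw [hlaw]
  exact hle

end ChannelInformation

/-! ### The network law as a channel from the inputs to each output. -/

section Network

variable {T : ℕ} (ρ : LinkStrengths) (p : ProbabilityMeasure (Inputs T))

instance (T : ℕ) : SFinite (noiseBlockLaw T) :=
  have : IsFiniteMeasure (noiseBlockLaw T) := inferInstance
  inferInstance

theorem map_networkLaw_input {𝓧 : Type*} [MeasurableSpace 𝓧] {π : Inputs T → 𝓧}
    (hπ : Measurable π) :
    (networkLaw ρ p).map (fun ω => π ω.1) = (p : Measure (Inputs T)).map π := by
  have h : (networkLaw ρ p).map Prod.fst = p := by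
    rw [networkLaw]; exact Measure.fst_prod
  rw [← h, Measure.map_map hπ measurable_fst]
  rfl

/-- Inputs are independent of gains and noise, so any function `s` of the latter is a channel state
independent of the part `π` of the inputs. -/
theorem map_networkLaw_channel {𝓧 𝓖 𝓨 : Type*} [MeasurableSpace 𝓧] [MeasurableSpace 𝓖]
    [MeasurableSpace 𝓨] {m : Measure 𝓖} [SFinite m] {π : Inputs T → 𝓧} (hπ : Measurable π)
    {s : Gains × Noise T → 𝓖} (hs : MeasurePreserving s ((gainLaw ρ).prod (noiseLaw T)) m)
    {φ : 𝓧 × 𝓖 → 𝓨} (hφ : Measurable φ) :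
    (networkLaw ρ p).map (fun ω => (π ω.1, φ (π ω.1, s ω.2)))
      = (((networkLaw ρ p).map fun ω => π ω.1).prod m).map fun a => (a.1, φ a) := by
  have h := (hπ.measurePreserving (p : Measure (Inputs T))).prod hs
  rw [map_networkLaw_input ρ p hπ, ← h.map_eq, Measure.map_map (by fun_prop) h.measurable]
  rfl

theorem measurePreserving_relayTwoState :
    MeasurePreserving (fun s : Gains × Noise T => (s.1.2.1, s.2.2.1))
      ((gainLaw ρ).prod (noiseLaw T)) ((complexGaussian ρ.sr2).prod (noiseBlockLaw T)) := by
  refine MeasurePreserving.prod (f := fun g : Gains => g.2.1) (g := fun w : Noise T => w.2.1) ?_ ?_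
  · exact measurePreserving_fst.comp measurePreserving_snd
  · exact measurePreserving_fst.comp measurePreserving_snd

theorem measurePreserving_destState :
    MeasurePreserving (fun s : Gains × Noise T => (s.1.2.2, s.2.2.2))
      ((gainLaw ρ).prod (noiseLaw T))
      (((complexGaussian ρ.rd1).prod (complexGaussian ρ.rd2)).prod (noiseBlockLaw T)) := by
  refine MeasurePreserving.prod (f := fun g : Gains => g.2.2) (g := fun w : Noise T => w.2.2) ?_ ?_
  · exact measurePreserving_snd.comp measurePreserving_snd
  · exact measurePreserving_snd.comp measurePreserving_snd

theorem measurePreserving_prodProdProdComm {α β γ δ : Type*} [MeasurableSpace α] [MeasurableSpace β]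
    [MeasurableSpace γ] [MeasurableSpace δ] (a : Measure α) (b : Measure β) (c : Measure γ)
    (d : Measure δ) [SFinite a] [SFinite b] [SFinite c] [SFinite d] :
    MeasurePreserving (fun s : (α × β) × γ × δ => ((s.1.1, s.2.1), (s.1.2, s.2.2)))
      ((a.prod b).prod (c.prod d)) ((a.prod c).prod (b.prod d)) := by
  refine ⟨by fun_prop, Measure.ext_of_lintegral _ fun F hF => ?_⟩
  rw [lintegral_map hF (by fun_prop), lintegral_prod _ (by fun_prop), lintegral_prod _ (by fun_prop),
    lintegral_prod _ hF.aemeasurable, lintegral_prod _ (by fun_prop)]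
  refine lintegral_congr fun x => ?_
  simp only
  have h1 : ∀ y : β, ∫⁻ z : γ × δ, F ((x, z.1), (y, z.2)) ∂(c.prod d)
      = ∫⁻ z, ∫⁻ w, F ((x, z), (y, w)) ∂d ∂c := fun y => lintegral_prod _ (by fun_prop)
  have h2 : ∀ z : γ, ∫⁻ q : β × δ, F ((x, z), q) ∂(b.prod d)
      = ∫⁻ y, ∫⁻ w, F ((x, z), (y, w)) ∂d ∂b := fun z => lintegral_prod _ (by fun_prop)
  simp only [h1, h2]
  refine lintegral_lintegral_swap (Measurable.aemeasurable ?_)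
  exact Measurable.lintegral_prod_right' (f := fun q : (β × γ) × δ => F ((x, q.1.2), (q.1.1, q.2)))
    (by fun_prop)

theorem measurePreserving_relaysState :
    MeasurePreserving
      (fun s : Gains × Noise T => ((s.1.1, s.2.1), (s.1.2.1, s.2.2.1)))
      ((gainLaw ρ).prod (noiseLaw T))
      (((complexGaussian ρ.sr1).prod (noiseBlockLaw T)).prod
        ((complexGaussian ρ.sr2).prod (noiseBlockLaw T))) := by
  have h := MeasurePreserving.prod (μa := gainLaw ρ) (μc := noiseLaw T)
    (μb := (complexGaussian ρ.sr1).prod (complexGaussian ρ.sr2))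
    (μd := (noiseBlockLaw T).prod (noiseBlockLaw T))
    (f := fun g : Gains => (g.1, g.2.1)) (g := fun w : Noise T => (w.1, w.2.1))
    (MeasurePreserving.prod (MeasurePreserving.id _) measurePreserving_fst)
    (MeasurePreserving.prod (MeasurePreserving.id _) measurePreserving_fst)
  exact (measurePreserving_prodProdProdComm _ _ _ _).comp h

@[fun_prop]
theorem measurable_YR1 : Measurable (YR1 : Outcome T → Block T) := by
  unfold YR1
  exact measurable_pi_lambda _ fun t => by fun_prop

@[fun_prop]
theorem measurable_YR2 : Measurable (YR2 : Outcome T → Block T) := by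
  unfold YR2
  exact measurable_pi_lambda _ fun t => by fun_prop

@[fun_prop]
theorem measurable_YD : Measurable (YD : Outcome T → Block T) := by
  unfold YD
  exact measurable_pi_lambda _ fun t => by fun_prop

end Network

end DiamondNetwork

namespace DiamondNetwork

open InformationTheory

/-! ### Elementary logarithmic estimates. -/

section LogBounds

theorem log_one_add_add_le {a b : ℝ} (ha : 0 ≤ a) (hb : 0 ≤ b) :
    Real.log (1 + (a + b)) ≤ Real.log (1 + b) + Real.log (1 + a) := by
  rw [← Real.log_mul (by positivity) (by positivity)]
  exact Real.log_le_log (by positivity) (by nlinarith [mul_nonneg ha hb])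

theorem log_one_add_mul_le {v t : ℝ} (hv : 1 ≤ v) (ht : 0 ≤ t) :
    Real.log (1 + v * t) ≤ Real.log v + Real.log (1 + t) := by
  rw [← Real.log_mul (by positivity) (by positivity)]
  exact Real.log_le_log (by positivity) (by nlinarith)

theorem lintegral_ofReal_mul_le {α : Type*} [MeasurableSpace α] {m : Measure α} {S : α → ℝ}
    (hS : Measurable S) {v t : ℝ} (hv : 0 ≤ v)
    (h : ∫⁻ a, ENNReal.ofReal (S a) ∂m ≤ ENNReal.ofReal t) :
    ∫⁻ a, ENNReal.ofReal (v * S a) ∂m ≤ ENNReal.ofReal (v * t) := by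
  simp_rw [ENNReal.ofReal_mul hv]
  rw [lintegral_const_mul _ (by fun_prop)]
  gcongr

theorem lintegral_isoExponent_le {T : ℕ} {α : Type*} [MeasurableSpace α] {m : Measure α}
    [IsProbabilityMeasure m] {Y : α → Block T} (hY : Measurable Y) {δ c : ℝ} (hδ : 0 < δ)
    (hc : 0 ≤ c) (h : ∫⁻ a, ENNReal.ofReal (sqNorm (Y a)) ∂m ≤ ENNReal.ofReal c) :
    ∫⁻ a, ENNReal.ofReal (isoExponent δ (Y a)) ∂m
      ≤ ENNReal.ofReal ((T + δ) * Real.log (1 + c)) :=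
  lintegral_ofReal_mul_le (by fun_prop) (by positivity)
    (lintegral_log_one_add_le (by fun_prop) (fun _ => sqNorm_nonneg _) hc h)

end LogBounds

/-! ### The source-to-relays side of the cuts. -/

section Broadcast

variable {T : ℕ}

/-- The isotropic reference costs `T + δ` copies of `log (1 + ρ ‖x‖²)` and the conditional density
gives one back; Jensen and the power constraint turn the rest into `log ρ`. -/
theorem exists_mutualInfo_YR2_le (hT : 0 < T) {δ : ℝ} (hδ : 0 < δ) :
    ∃ C : ℝ, ∀ ρ : LinkStrengths, 1 ≤ ρ.sr2 → ∀ p : ProbabilityMeasure (Inputs T),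
      PowerConstraint p → (mutualInfo XS YR2 (networkLaw ρ p) : EReal)
        ≤ ((((T : ℝ) - 1 + δ) * Real.log ρ.sr2 + C : ℝ) : EReal) := by
  obtain ⟨K, hK0, hK⟩ := exists_lintegral_isoExponent_le T hδ
  refine ⟨Real.log (4 * Real.pi ^ 2) + (T + δ) * Real.log (1 + T)
    + ((T : ℝ) - 1 + δ) * Real.log (1 + T) + K, fun ρ hρ p hp => ?_⟩
  have hT1 : (1 : ℝ) ≤ T := by exact_mod_cast hT
  have hv1 : (1 : ℝ) ≤ ρ.sr2 := by exact_mod_cast hρ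
  have hv0 : ρ.sr2 ≠ 0 := (zero_lt_one.trans_le hρ).ne'
  have hX : Measurable (XS : Outcome T → Block T) := by unfold XS; fun_prop
  have hq : (networkLaw ρ p).map XS = (p : Measure (Inputs T)).map Prod.fst :=
    map_networkLaw_input ρ p measurable_fst
  have : IsProbabilityMeasure ((networkLaw ρ p).map XS) :=
    Measure.isProbabilityMeasure_map hX.aemeasurable
  have hpow : ∫⁻ x, ENNReal.ofReal (ρ.sr2 * sqNorm x) ∂((networkLaw ρ p).map XS)
      ≤ ENNReal.ofReal (ρ.sr2 * T) := by
    refine lintegral_ofReal_mul_le (by fun_prop) (by positivity) (le_of_eq ?_)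
    rw [hq, lintegral_map (by fun_prop) measurable_fst, ENNReal.ofReal_natCast, ← hp.1]
    simp_rw [ofReal_sqNorm]
  have hS0 : ∀ x : Block T, 0 ≤ ρ.sr2 * sqNorm x := fun x =>
    mul_nonneg (by positivity) (sqNorm_nonneg x)
  have hi := integrable_log_one_add (by fun_prop) hS0 (by positivity) hpow
  have hle := integral_log_one_add_le (by fun_prop) hS0 (by positivity) hpow
  have hci : Integrable (fun x : Block T => Real.log (4 * Real.pi ^ 2)
      - Real.log (1 + ρ.sr2 * sqNorm x)) ((networkLaw ρ p).map XS) := (integrable_const _).sub hi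
  have hBi : Integrable (fun x : Block T => (T + δ) * (Real.log (1 + T)
      + Real.log (1 + ρ.sr2 * sqNorm x))) ((networkLaw ρ p).map XS) :=
    ((integrable_const _).add hi).const_mul _
  have hpi := Real.pi_pos
  have hlaw : (networkLaw ρ p).map (fun ω => (XS ω, YR2 ω))
      = (((networkLaw ρ p).map XS).prod ((complexGaussian ρ.sr2).prod (noiseBlockLaw T))).map
        fun a => (a.1, a.2.1 • a.1 + a.2.2) :=
    map_networkLaw_channel ρ p measurable_fst (measurePreserving_relayTwoState ρ)
      (φ := fun a : Block T × ℂ × Block T => a.2.1 • a.1 + a.2.2) (by fun_prop)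
  refine (mutualInfo_channel_le (l := volume) hX measurable_YR2 (by fun_prop)
    hlaw
    (by fun_prop) hci hBi (fun x => ?_) (measurable_isoExponent δ) (isoExponent_nonneg hδ)
    (fun x F hF => ?_) (fun x => ?_) hK0 hK).trans ?_
  · exact mul_nonneg (by positivity) (add_nonneg (Real.log_nonneg (by linarith))
      (Real.log_nonneg (by linarith [hS0 x])))
  · have h1 := hS0 x
    rw [lintegral_prod _ (by fun_prop), Real.exp_sub, Real.exp_log (by positivity),
      Real.exp_log (by positivity)]
    exact lintegral_gain_noise_le hT hv0 x hF
  · have h1 := hS0 x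
    refine (lintegral_isoExponent_le (by fun_prop) hδ (by positivity)
      (lintegral_sqNorm_gain ρ.sr2 x).le).trans (ENNReal.ofReal_le_ofReal ?_)
    gcongr
    exact log_one_add_add_le h1 (by positivity)
  · rw [EReal.coe_le_coe_iff, integral_sub (integrable_const _) hi, integral_const_mul,
      integral_add (integrable_const _) hi]
    simp only [integral_const, probReal_univ, smul_eq_mul, one_mul]
    have h2 := hle.trans (log_one_add_mul_le hv1 (by positivity))
    have h3 := mul_le_mul_of_nonneg_left h2 (show 0 ≤ (T : ℝ) - 1 + δ by linarith)
    linarith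

/-- Subtracting `g₂/g₁` times the first output from the second cancels the signal `x`, so the part
of the second output orthogonal to the first comes only from `w₂ - (g₂/g₁) w₁`. The bound is uniform
in `x` and in the variances. -/
theorem lintegral_log_one_add_sqNorm_perp_le (hT : 0 < T) {L : ℝ} (hL0 : 0 ≤ L) {v₁ v₂ : ℝ≥0}
    (h₁ : v₁ ≠ 0) (h₂₁ : v₂ ≤ v₁)
    (hL : ∫⁻ g, ENNReal.ofReal (Real.log (1 + v₁ / ‖g‖ ^ 2)) ∂(complexGaussian v₁)
      ≤ ENNReal.ofReal L) (x : Block T) :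
    ∫⁻ s, ENNReal.ofReal (Real.log (1 + sqNorm (perp (unitDir (s.1.1 • x + s.1.2))
      (s.2.1 • x + s.2.2)))) ∂(((complexGaussian v₁).prod (noiseBlockLaw T)).prod
        ((complexGaussian v₂).prod (noiseBlockLaw T)))
      ≤ ENNReal.ofReal (Real.log (1 + 2 * T) + Real.log (1 + 2 * T) + L) := by
  have hv₁ : (0 : ℝ) < v₁ := by positivity
  set m₁ := (complexGaussian v₁).prod (noiseBlockLaw T) with hm₁
  set m₂ := (complexGaussian v₂).prod (noiseBlockLaw T) with hm₂
  have hpt : ∀ s : (ℂ × Block T) × ℂ × Block T, s.1.1 ≠ 0 →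
      Real.log (1 + sqNorm (perp (unitDir (s.1.1 • x + s.1.2)) (s.2.1 • x + s.2.2)))
        ≤ Real.log (1 + 2 * sqNorm s.2.2)
          + Real.log (1 + 2 / v₁ * (‖s.2.1‖ ^ 2 * sqNorm s.1.2))
          + Real.log (1 + v₁ / ‖s.1.1‖ ^ 2) := by
    rintro ⟨⟨g₁, w₁⟩, g₂, w₂⟩ hg
    simp only at hg ⊢
    set u := unitDir (g₁ • x + w₁) with hu
    have hu1 : sqNorm u = 1 := sqNorm_unitDir hT _
    have hdec : g₂ • x + w₂ = (g₂ / g₁) • (g₁ • x + w₁) + (w₂ + (-(g₂ / g₁)) • w₁) := by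
      rw [smul_add, smul_smul, div_mul_cancel₀ _ hg, neg_smul]; abel
    have hperp : perp u (g₂ • x + w₂) = perp u (w₂ + (-(g₂ / g₁)) • w₁) := by
      rw [hdec, perp_add, perp_smul, hu, perp_unitDir_self hT, smul_zero, zero_add]
    have hg0 : 0 < ‖g₁‖ := norm_pos_iff.2 hg
    have hS1 := sqNorm_nonneg w₁
    have hS2 := sqNorm_nonneg w₂
    -- The ratio `‖g₂‖²/‖g₁‖²` is split through `v₁`, because `1/‖g₁‖²` has no finite mean, only a
    -- finite logarithmic moment. The bound `a + b d` is then absorbed into `(1 + a)(1 + b)(1 + d)`.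
    have hb : sqNorm (perp u (g₂ • x + w₂))
        ≤ 2 * sqNorm w₂ + 2 / v₁ * (‖g₂‖ ^ 2 * sqNorm w₁) * (v₁ / ‖g₁‖ ^ 2) := by
      rw [hperp]
      refine (sqNorm_perp_le hu1 _).trans ((sqNorm_add_le _ _).trans (le_of_eq ?_))
      rw [sqNorm_smul, norm_neg, norm_div, div_pow]
      field_simp
    rw [← Real.log_mul (by positivity) (by positivity), ← Real.log_mul (by positivity)
      (by positivity)]
    refine Real.log_le_log (by linarith [sqNorm_nonneg (perp u (g₂ • x + w₂))]) ?_
    set a := 2 * sqNorm w₂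
    set b := 2 / v₁ * (‖g₂‖ ^ 2 * sqNorm w₁)
    set d := (v₁ : ℝ) / ‖g₁‖ ^ 2
    have ha : 0 ≤ a := by positivity
    have hb0 : 0 ≤ b := by positivity
    have hd : 0 ≤ d := by positivity
    nlinarith [mul_nonneg ha hb0, mul_nonneg ha hd, mul_nonneg (mul_nonneg ha hb0) hd]
  have hae : ∀ᵐ s ∂(m₁.prod m₂), s.1.1 ≠ 0 := by
    have h0 : complexGaussian v₁ {0} = 0 := by
      rw [← lintegral_indicator_one (measurableSet_singleton _)]
      refine le_antisymm ((lintegral_complexGaussian_le h₁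
        (measurable_one.indicator (measurableSet_singleton _))).trans ?_) zero_le
      rw [lintegral_indicator_one (measurableSet_singleton _)]
      simp
    have h1 : ∀ᵐ g ∂(complexGaussian v₁), g ≠ 0 := by
      rw [ae_iff]; simpa using h0
    have hmp : MeasurePreserving (fun s : (ℂ × Block T) × ℂ × Block T => s.1.1) (m₁.prod m₂)
        (complexGaussian v₁) := measurePreserving_fst.comp measurePreserving_fst
    exact hmp.quasiMeasurePreserving.ae h1
  have hA : ∫⁻ s, ENNReal.ofReal (Real.log (1 + 2 * sqNorm s.2.2)) ∂(m₁.prod m₂)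
      ≤ ENNReal.ofReal (Real.log (1 + 2 * T)) := by
    have hmp : MeasurePreserving (fun s : (ℂ × Block T) × ℂ × Block T => s.2.2) (m₁.prod m₂)
        (noiseBlockLaw T) := measurePreserving_snd.comp measurePreserving_snd
    rw [hmp.lintegral_comp (f := fun w => ENNReal.ofReal (Real.log (1 + 2 * sqNorm w)))
      (by fun_prop)]
    refine lintegral_log_one_add_le (by fun_prop)
      (fun w => mul_nonneg zero_le_two (sqNorm_nonneg w)) (by positivity) ?_
    exact lintegral_ofReal_mul_le (by fun_prop) zero_le_two lintegral_sqNorm_noise.le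
  have hB : ∫⁻ s, ENNReal.ofReal (Real.log (1 + 2 / v₁ * (‖s.2.1‖ ^ 2 * sqNorm s.1.2)))
      ∂(m₁.prod m₂) ≤ ENNReal.ofReal (Real.log (1 + 2 * T)) := by
    have hmean : ∫⁻ s, ENNReal.ofReal (2 / v₁ * (‖s.2.1‖ ^ 2 * sqNorm s.1.2)) ∂(m₁.prod m₂)
        ≤ ENNReal.ofReal (2 / v₁ * (v₂ * T)) := by
      refine lintegral_ofReal_mul_le (by fun_prop) (by positivity) (le_of_eq ?_)
      rw [lintegral_prod _ (by fun_prop)]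
      have hg : ∫⁻ s, ENNReal.ofReal (‖s.1‖ ^ 2) ∂m₂ = ENNReal.ofReal v₂ := by
        have hmp : MeasurePreserving (Prod.fst : ℂ × Block T → ℂ) m₂ (complexGaussian v₂) :=
          measurePreserving_fst
        rw [hmp.lintegral_comp (f := fun g => ENNReal.ofReal (‖g‖ ^ 2)) (by fun_prop)]
        have := lintegral_norm_add_mul_sq_complexGaussian v₂ 0 1
        simpa using this
      have hw : ∫⁻ s, ENNReal.ofReal (sqNorm s.2) ∂m₁ = ENNReal.ofReal T := by
        have hmp : MeasurePreserving (Prod.snd : ℂ × Block T → Block T) m₁ (noiseBlockLaw T) :=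
          measurePreserving_snd
        rw [hmp.lintegral_comp (f := fun w => ENNReal.ofReal (sqNorm w)) (by fun_prop),
          lintegral_sqNorm_noise]
      simp_rw [ENNReal.ofReal_mul (sq_nonneg _)]
      have : ∀ s : ℂ × Block T, ∫⁻ r, ENNReal.ofReal (‖r.1‖ ^ 2) * ENNReal.ofReal (sqNorm s.2) ∂m₂
          = ENNReal.ofReal v₂ * ENNReal.ofReal (sqNorm s.2) := fun s => by
        rw [lintegral_mul_const _ (by fun_prop), hg]
      simp only [this]
      rw [lintegral_const_mul _ (by fun_prop), hw, ENNReal.ofReal_mul (by positivity)]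
    refine (lintegral_log_one_add_le (by fun_prop) (fun s => ?_) (by positivity) hmean).trans ?_
    · have := sqNorm_nonneg s.1.2
      positivity
    · refine ENNReal.ofReal_le_ofReal (Real.log_le_log (by positivity) ?_)
      -- This is where the first relay must be the stronger one: the mean is `2T v₂/v₁`.
      have h21 : (v₂ : ℝ) ≤ v₁ := by exact_mod_cast h₂₁
      have : 2 / (v₁ : ℝ) * (v₂ * T) = 2 * T * (v₂ / v₁) := by ring
      rw [this]
      have h3 : (v₂ : ℝ) / v₁ ≤ 1 := (div_le_one hv₁).2 h21
      nlinarith [show (0 : ℝ) ≤ 2 * T by positivity]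
  have hC : ∫⁻ s, ENNReal.ofReal (Real.log (1 + v₁ / ‖s.1.1‖ ^ 2)) ∂(m₁.prod m₂)
      ≤ ENNReal.ofReal L := by
    have hmp : MeasurePreserving (fun s : (ℂ × Block T) × ℂ × Block T => s.1.1) (m₁.prod m₂)
        (complexGaussian v₁) := measurePreserving_fst.comp measurePreserving_fst
    rw [hmp.lintegral_comp (f := fun g => ENNReal.ofReal (Real.log (1 + v₁ / ‖g‖ ^ 2)))
      (by fun_prop)]
    exact hL
  have hlT : 0 ≤ Real.log (1 + 2 * T) :=
    Real.log_nonneg (by linarith [show (0 : ℝ) ≤ 2 * T by positivity])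
  calc _ ≤ ∫⁻ s, (ENNReal.ofReal (Real.log (1 + 2 * sqNorm s.2.2))
          + ENNReal.ofReal (Real.log (1 + 2 / v₁ * (‖s.2.1‖ ^ 2 * sqNorm s.1.2)))
          + ENNReal.ofReal (Real.log (1 + v₁ / ‖s.1.1‖ ^ 2))) ∂(m₁.prod m₂) := by
        refine lintegral_mono_ae ?_
        filter_upwards [hae] with s hs
        refine (ENNReal.ofReal_le_ofReal (hpt s hs)).trans ?_
        exact ENNReal.ofReal_add_le.trans (add_le_add_left ENNReal.ofReal_add_le _)
    _ ≤ ENNReal.ofReal (Real.log (1 + 2 * T)) + ENNReal.ofReal (Real.log (1 + 2 * T))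
          + ENNReal.ofReal L := by
        rw [lintegral_add_right _ (by fun_prop), lintegral_add_right _ (by fun_prop)]
        gcongr
    _ = _ := by
        rw [← ENNReal.ofReal_add hlT hlT, ← ENNReal.ofReal_add (by positivity) hL0]

/-- The exponents cost `T + δ` logarithms at strength `sr1` and `1 + δ` at strength `sr2`, plus a
constant for the orthogonal part; the conditional densities give back one of each. The residual `δ
log sr2` is charged to `sr1`, hence `2 * δ`. -/
theorem exists_mutualInfo_YR1_YR2_le (hT : 0 < T) {δ : ℝ} (hδ : 0 < δ) :
    ∃ C : ℝ, ∀ ρ : LinkStrengths, 1 ≤ ρ.sr2 → ρ.sr2 ≤ ρ.sr1 →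
      ∀ p : ProbabilityMeasure (Inputs T), PowerConstraint p →
      (mutualInfo XS (fun ω => (YR1 ω, YR2 ω)) (networkLaw ρ p) : EReal)
        ≤ ((((T : ℝ) - 1 + 2 * δ) * Real.log ρ.sr1 + C : ℝ) : EReal) := by
  obtain ⟨K₁, hK₁0, hK₁⟩ := exists_lintegral_isoExponent_le T hδ
  obtain ⟨K₂, hK₂0, hK₂⟩ := exists_lintegral_dirExponent_le hT hδ
  obtain ⟨L, hL0, hL⟩ := exists_lintegral_log_one_add_div_le
  set M := Real.log (1 + 2 * T) + Real.log (1 + 2 * T) + L with hM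
  refine ⟨2 * Real.log (4 * Real.pi ^ 2) + (T + δ) * Real.log (1 + T)
    + (1 + δ) * Real.log (1 + T) + ((T : ℝ) - 1 + δ) * M
    + ((T : ℝ) - 1 + 2 * δ) * Real.log (1 + T) + K₁ * K₂, fun ρ hρ hρ12 p hp => ?_⟩
  have hT1 : (1 : ℝ) ≤ T := by exact_mod_cast hT
  have hv2 : (1 : ℝ) ≤ ρ.sr2 := by exact_mod_cast hρ
  have hv12 : (ρ.sr2 : ℝ) ≤ ρ.sr1 := by exact_mod_cast hρ12
  have hv1 : (1 : ℝ) ≤ ρ.sr1 := hv2.trans hv12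
  have hv2' : ρ.sr2 ≠ 0 := (zero_lt_one.trans_le hρ).ne'
  have hv1' : ρ.sr1 ≠ 0 := (zero_lt_one.trans_le (hρ.trans hρ12)).ne'
  have hlT : 0 ≤ Real.log (1 + 2 * T) :=
    Real.log_nonneg (by linarith [show (0 : ℝ) ≤ 2 * T by positivity])
  have hM0 : 0 ≤ M := by positivity
  have hX : Measurable (XS : Outcome T → Block T) := by unfold XS; fun_prop
  have hY : Measurable fun ω : Outcome T => (YR1 ω, YR2 ω) := by fun_prop
  have hq : (networkLaw ρ p).map XS = (p : Measure (Inputs T)).map Prod.fst :=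
    map_networkLaw_input ρ p measurable_fst
  have : IsProbabilityMeasure ((networkLaw ρ p).map XS) :=
    Measure.isProbabilityMeasure_map hX.aemeasurable
  have hpow : ∀ v : ℝ≥0, ∫⁻ x, ENNReal.ofReal (v * sqNorm x) ∂((networkLaw ρ p).map XS)
      ≤ ENNReal.ofReal (v * T) := fun v => by
    refine lintegral_ofReal_mul_le (by fun_prop) (by positivity) (le_of_eq ?_)
    rw [hq, lintegral_map (by fun_prop) measurable_fst, ENNReal.ofReal_natCast, ← hp.1]
    simp_rw [ofReal_sqNorm]
  have hS0 : ∀ (v : ℝ≥0) (x : Block T), 0 ≤ v * sqNorm x := fun v x =>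
    mul_nonneg (by positivity) (sqNorm_nonneg x)
  have hi := fun v : ℝ≥0 => integrable_log_one_add (by fun_prop) (hS0 v) (by positivity) (hpow v)
  have hle := fun v : ℝ≥0 => integral_log_one_add_le (by fun_prop) (hS0 v) (by positivity) (hpow v)
  have hci0 : Integrable (fun x : Block T => 2 * Real.log (4 * Real.pi ^ 2)
      - Real.log (1 + ρ.sr1 * sqNorm x)) ((networkLaw ρ p).map XS) :=
    (integrable_const _).sub (hi _)
  have hci : Integrable (fun x : Block T => 2 * Real.log (4 * Real.pi ^ 2)
      - Real.log (1 + ρ.sr1 * sqNorm x) - Real.log (1 + ρ.sr2 * sqNorm x))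
      ((networkLaw ρ p).map XS) := hci0.sub (hi _)
  have hB₁ : Integrable (fun x : Block T => (T + δ) * (Real.log (1 + T)
      + Real.log (1 + ρ.sr1 * sqNorm x))) ((networkLaw ρ p).map XS) :=
    ((integrable_const _).add (hi _)).const_mul _
  have hB₂ : Integrable (fun x : Block T => (1 + δ) * (Real.log (1 + T)
      + Real.log (1 + ρ.sr2 * sqNorm x))) ((networkLaw ρ p).map XS) :=
    ((integrable_const _).add (hi _)).const_mul _
  have hB₁₂ : Integrable (fun x : Block T => (T + δ) * (Real.log (1 + T)
      + Real.log (1 + ρ.sr1 * sqNorm x)) + (1 + δ) * (Real.log (1 + T)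
      + Real.log (1 + ρ.sr2 * sqNorm x))) ((networkLaw ρ p).map XS) := hB₁.add hB₂
  have hBi : Integrable (fun x : Block T => (T + δ) * (Real.log (1 + T)
      + Real.log (1 + ρ.sr1 * sqNorm x)) + (1 + δ) * (Real.log (1 + T)
      + Real.log (1 + ρ.sr2 * sqNorm x)) + ((T : ℝ) - 1 + δ) * M) ((networkLaw ρ p).map XS) :=
    hB₁₂.add (integrable_const _)
  have hpi := Real.pi_pos
  have hlog0 : ∀ (v : ℝ≥0) (x : Block T), 0 ≤ Real.log (1 + v * sqNorm x) := fun v x =>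
    Real.log_nonneg (by linarith [hS0 v x])
  have hlT1 : 0 ≤ Real.log (1 + (T : ℝ)) := Real.log_nonneg (by linarith)
  have hTδ : 0 ≤ (T : ℝ) - 1 + δ := by linarith
  set m₁ := (complexGaussian ρ.sr1).prod (noiseBlockLaw T) with hm₁
  set m₂ := (complexGaussian ρ.sr2).prod (noiseBlockLaw T) with hm₂
  have hlaw : (networkLaw ρ p).map (fun ω => (XS ω, YR1 ω, YR2 ω))
      = (((networkLaw ρ p).map XS).prod (m₁.prod m₂)).map
        fun a => (a.1, a.2.1.1 • a.1 + a.2.1.2, a.2.2.1 • a.1 + a.2.2.2) :=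
    map_networkLaw_channel ρ p measurable_fst (measurePreserving_relaysState ρ)
      (φ := fun a : Block T × (ℂ × Block T) × ℂ × Block T =>
        (a.2.1.1 • a.1 + a.2.1.2, a.2.2.1 • a.1 + a.2.2.2)) (by fun_prop)
  refine (mutualInfo_channel_le (l := (volume : Measure (Block T)).prod volume) hX hY
    (φ := fun a : Block T × (ℂ × Block T) × ℂ × Block T =>
      (a.2.1.1 • a.1 + a.2.1.2, a.2.2.1 • a.1 + a.2.2.2)) (by fun_prop)
    hlaw
    (by fun_prop) hci hBi (fun x => ?_)
    (A := fun y => isoExponent δ y.1 + dirExponent δ (unitDir y.1) y.2) (by fun_prop)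
    (fun y => add_nonneg (isoExponent_nonneg hδ _) (dirExponent_nonneg hT hδ _ _))
    (fun x F hF => ?_) (fun x => ?_) (mul_nonneg hK₁0 hK₂0) ?_).trans ?_
  · have h1 := hlog0 ρ.sr1 x
    have h2 := hlog0 ρ.sr2 x
    positivity
  · have h1 := hS0 ρ.sr1 x
    have h2 := hS0 ρ.sr2 x
    have hF' : Measurable fun y₁ => ∫⁻ y₂, F (y₁, y₂) := hF.lintegral_prod_right'
    have hF'' : Measurable fun s : ℂ × Block T => ∫⁻ y₂, F (s.1 • x + s.2, y₂) :=
      hF'.comp (by fun_prop : Measurable fun s : ℂ × Block T => s.1 • x + s.2)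
    -- Given `x` the two relay outputs are independent, so their density bounds multiply.
    calc ∫⁻ s, F (s.1.1 • x + s.1.2, s.2.1 • x + s.2.2) ∂(m₁.prod m₂)
        = ∫⁻ s₁, ∫⁻ s₂, F (s₁.1 • x + s₁.2, s₂.1 • x + s₂.2) ∂m₂ ∂m₁ :=
          lintegral_prod _ (by fun_prop)
      _ ≤ ∫⁻ s₁, ENNReal.ofReal (4 * Real.pi ^ 2 / (1 + ρ.sr2 * sqNorm x))
            * ∫⁻ y₂, F (s₁.1 • x + s₁.2, y₂) ∂volume ∂m₁ := by
          refine lintegral_mono fun s₁ => ?_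
          dsimp only
          rw [hm₂, lintegral_prod _ (by fun_prop)]
          exact lintegral_gain_noise_le hT hv2' x (F := fun y => F (s₁.1 • x + s₁.2, y))
            (by fun_prop)
      _ = ENNReal.ofReal (4 * Real.pi ^ 2 / (1 + ρ.sr2 * sqNorm x))
            * ∫⁻ s₁, ∫⁻ y₂, F (s₁.1 • x + s₁.2, y₂) ∂volume ∂m₁ :=
          lintegral_const_mul _ hF''
      _ ≤ ENNReal.ofReal (4 * Real.pi ^ 2 / (1 + ρ.sr2 * sqNorm x))
            * (ENNReal.ofReal (4 * Real.pi ^ 2 / (1 + ρ.sr1 * sqNorm x))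
              * ∫⁻ y₁, ∫⁻ y₂, F (y₁, y₂)) := by
          refine mul_le_mul_right ?_ _
          rw [hm₁, lintegral_prod _ hF''.aemeasurable]
          exact lintegral_gain_noise_le hT hv1' x hF'
      _ = _ := by
          rw [← mul_assoc, ← ENNReal.ofReal_mul (by positivity), lintegral_prod _ hF.aemeasurable]
          congr 2
          rw [sub_sub, Real.exp_sub, Real.exp_add, Real.exp_log (by positivity),
            Real.exp_log (by positivity), two_mul, Real.exp_add, Real.exp_log (by positivity)]
          field_simp
  · have h1 := hS0 ρ.sr1 x
    have h2 := hS0 ρ.sr2 x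
    have hiso : ∫⁻ s, ENNReal.ofReal (isoExponent δ (s.1.1 • x + s.1.2)) ∂(m₁.prod m₂)
        ≤ ENNReal.ofReal ((T + δ) * (Real.log (1 + T) + Real.log (1 + ρ.sr1 * sqNorm x))) := by
      have hmp : MeasurePreserving (Prod.fst : (ℂ × Block T) × ℂ × Block T → _) (m₁.prod m₂) m₁ :=
        measurePreserving_fst
      rw [hmp.lintegral_comp (f := fun s => ENNReal.ofReal (isoExponent δ (s.1 • x + s.2)))
        (by fun_prop)]
      refine (lintegral_isoExponent_le (by fun_prop) hδ (by positivity)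
        (lintegral_sqNorm_gain ρ.sr1 x).le).trans (ENNReal.ofReal_le_ofReal ?_)
      gcongr
      exact log_one_add_add_le h1 (by positivity)
    have hpar : ∫⁻ s, ENNReal.ofReal ((1 + δ) * Real.log (1 + sqNorm (s.2.1 • x + s.2.2)))
        ∂(m₁.prod m₂)
        ≤ ENNReal.ofReal ((1 + δ) * (Real.log (1 + T) + Real.log (1 + ρ.sr2 * sqNorm x))) := by
      have hmp : MeasurePreserving (Prod.snd : (ℂ × Block T) × ℂ × Block T → _) (m₁.prod m₂) m₂ :=
        measurePreserving_snd
      refine lintegral_ofReal_mul_le (by fun_prop) (by positivity) ?_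
      rw [hmp.lintegral_comp (f := fun s => ENNReal.ofReal (Real.log (1 + sqNorm (s.1 • x + s.2))))
        (by fun_prop)]
      refine (lintegral_log_one_add_le (by fun_prop) (fun _ => sqNorm_nonneg _) (by positivity)
        (lintegral_sqNorm_gain ρ.sr2 x).le).trans (ENNReal.ofReal_le_ofReal ?_)
      exact log_one_add_add_le h2 (by positivity)
    have hperp := lintegral_ofReal_mul_le (by fun_prop) hTδ
      (lintegral_log_one_add_sqNorm_perp_le hT hL0 hv1' hρ12 (hL _ hv1') x)
    have hl1 := hlog0 ρ.sr1 x
    have hl2 := hlog0 ρ.sr2 x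
    rw [ENNReal.ofReal_add (by positivity) (by positivity),
      ENNReal.ofReal_add (by positivity) (by positivity)]
    refine le_trans ?_ (add_le_add (add_le_add hiso hpar) hperp)
    rw [← lintegral_add_left (by fun_prop), ← lintegral_add_left (by fun_prop)]
    refine lintegral_mono fun s => ?_
    dsimp only
    refine le_trans (ENNReal.ofReal_le_ofReal ?_)
      (ENNReal.ofReal_add_le.trans (add_le_add_left ENNReal.ofReal_add_le _))
    rw [dirExponent, ← add_assoc]
    gcongr
    exact norm_herm_sq_le (sqNorm_unitDir hT _) _
  · rw [lintegral_prod _ (by fun_prop)]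
    calc _ ≤ ∫⁻ y₁ : Block T, ENNReal.ofReal (Real.exp (-isoExponent δ y₁))
            * ENNReal.ofReal K₂ := by
          refine lintegral_mono fun y₁ => ?_
          dsimp only
          simp_rw [neg_add, Real.exp_add, ENNReal.ofReal_mul (Real.exp_pos _).le]
          rw [lintegral_const_mul _ (by fun_prop)]
          exact mul_le_mul_right (hK₂ _ (sqNorm_unitDir hT _)) _
      _ ≤ _ := by
          rw [lintegral_mul_const _ (by fun_prop), ENNReal.ofReal_mul hK₁0]
          exact mul_le_mul_left hK₁ _
  · rw [EReal.coe_le_coe_iff, integral_sub hci0 (hi _), integral_sub (integrable_const _) (hi _),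
      integral_add hB₁₂ (integrable_const _), integral_add hB₁ hB₂, integral_const_mul,
      integral_const_mul, integral_const_mul, integral_add (integrable_const _) (hi _),
      integral_add (integrable_const _) (hi _)]
    simp only [integral_const, probReal_univ, smul_eq_mul, one_mul]
    have h1 := (hle ρ.sr1).trans (log_one_add_mul_le hv1 (by positivity))
    have h2 := (hle ρ.sr2).trans (log_one_add_mul_le hv2 (by positivity))
    have h12 : Real.log ρ.sr2 ≤ Real.log ρ.sr1 := Real.log_le_log (by linarith) hv12
    have h3 := mul_le_mul_of_nonneg_left h1 hTδ
    have h4 := mul_le_mul_of_nonneg_left (h2.trans (add_le_add_left h12 _)) hδ.le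
    linarith

end Broadcast

end DiamondNetwork

namespace DiamondNetwork

open InformationTheory

/-! ### The relays-to-destination side and its identification with `ψ₁`, `ψ₂`. -/

section MultipleAccess

variable {T : ℕ}

/-- The norm of the second relay's block, and the components of the first relay's block along and
orthogonal to it. -/
noncomputable def relayCoords (x : Inputs T) : ℂ × ℂ × ℂ :=
  ((√(sqNorm x.2.2) : ℂ), herm (unitDir x.2.2) x.2.1, (√(sqNorm (perp (unitDir x.2.2) x.2.1)) : ℂ))

@[fun_prop]
theorem measurable_relayCoords : Measurable (relayCoords : Inputs T → ℂ × ℂ × ℂ) := by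
  unfold relayCoords; fun_prop

/-- The law of the coordinates of the relays' blocks. -/
noncomputable def relayLaw (p : ProbabilityMeasure (Inputs T)) : ProbabilityMeasure (ℂ × ℂ × ℂ) :=
  p.map measurable_relayCoords.aemeasurable

theorem norm_ofReal_sqrt_sq {a : ℝ} (ha : 0 ≤ a) : ‖(√a : ℂ)‖ ^ 2 = a := by
  rw [Complex.norm_real, Real.norm_of_nonneg (Real.sqrt_nonneg _), Real.sq_sqrt ha]

theorem norm_relayCoords_fst_sq (x : Inputs T) : ‖(relayCoords x).1‖ ^ 2 = sqNorm x.2.2 :=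
  norm_ofReal_sqrt_sq (sqNorm_nonneg _)

theorem norm_relayCoords_snd_snd_sq (x : Inputs T) :
    ‖(relayCoords x).2.2‖ ^ 2 = sqNorm (perp (unitDir x.2.2) x.2.1) :=
  norm_ofReal_sqrt_sq (sqNorm_nonneg _)

theorem sqNorm_eq_relayCoords (hT : 0 < T) (x : Inputs T) :
    sqNorm x.2.1 = ‖(relayCoords x).2.1‖ ^ 2 + ‖(relayCoords x).2.2‖ ^ 2 := by
  rw [norm_relayCoords_snd_snd_sq, sqNorm_eq_herm_add_perp (sqNorm_unitDir hT x.2.2) x.2.1]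
  rfl

/-- This is why these coordinates are the right ones: the covariance determinant depends on the two
blocks only through them. -/
theorem logDet_relayCoords (hT : 0 < T) (ρ : LinkStrengths) (x : Inputs T) :
    logDet ρ (relayCoords x) = Real.log (covDet ρ.rd1 ρ.rd2 x.2.1 x.2.2) := by
  rw [logDet, covDet, sqNorm_eq_relayCoords hT x, ← norm_relayCoords_snd_snd_sq,
    ← norm_relayCoords_fst_sq x]
  congr 1
  ring

theorem integral_relayLaw (p : ProbabilityMeasure (Inputs T)) {f : ℂ × ℂ × ℂ → ℝ}
    (hf : Measurable f) :
    ∫ a, f a ∂(relayLaw p : Measure (ℂ × ℂ × ℂ))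
      = ∫ x, f (relayCoords x) ∂(p : Measure (Inputs T)) := by
  rw [relayLaw, ProbabilityMeasure.toMeasure_map,
    integral_map measurable_relayCoords.aemeasurable hf.aestronglyMeasurable]

theorem feasible_relayLaw (hT : 0 < T) {p : ProbabilityMeasure (Inputs T)}
    (hp : PowerConstraint p) : Feasible T (relayLaw p) := by
  have he : ∀ z : ℂ, ‖z‖ₑ ^ 2 = ENNReal.ofReal (‖z‖ ^ 2) := fun z => by
    rw [ENNReal.ofReal_pow (norm_nonneg _), ofReal_norm]
  refine ⟨le_of_eq ?_, le_of_eq ?_⟩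
  · rw [relayLaw, ProbabilityMeasure.toMeasure_map, lintegral_map (by fun_prop) (by fun_prop),
      ← hp.2.2]
    refine lintegral_congr fun x => ?_
    rw [he, norm_relayCoords_fst_sq, ofReal_sqNorm]
  · rw [relayLaw, ProbabilityMeasure.toMeasure_map, lintegral_map (by fun_prop) (by fun_prop),
      ← hp.2.1]
    refine lintegral_congr fun x => ?_
    rw [he, he, ← ENNReal.ofReal_add (by positivity) (by positivity), ← sqNorm_eq_relayCoords hT,
      ofReal_sqNorm]

theorem log_one_add_le_log_two_add {a : ℝ} (ha : 1 ≤ a) :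
    Real.log (1 + a) ≤ Real.log 2 + Real.log a := by
  rw [← Real.log_mul two_ne_zero (by positivity)]
  exact Real.log_le_log (by positivity) (by linarith)

variable (ρ : LinkStrengths) {p : ProbabilityMeasure (Inputs T)}

/-- The logarithm of anything below the mean received energy is integrable, and its mean is
controlled by the link strengths. -/
theorem integral_log_received_le (hp : PowerConstraint p) {W : Inputs T → ℝ} (hW : Measurable W)
    (hW0 : ∀ x, 0 ≤ W x)
    (hle : ∀ x, W x ≤ ρ.rd1 * sqNorm x.2.1 + ρ.rd2 * sqNorm x.2.2 + T) :
    Integrable (fun x => Real.log (1 + W x)) (p : Measure (Inputs T)) ∧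
      ∫ x, Real.log (1 + W x) ∂(p : Measure (Inputs T))
        ≤ Real.log (1 + ρ.rd1 + ρ.rd2) + Real.log (1 + T) := by
  have h0 : ∀ x : Inputs T, 0 ≤ ρ.rd1 * sqNorm x.2.1 := fun x =>
    mul_nonneg (by positivity) (sqNorm_nonneg _)
  have h0' : ∀ x : Inputs T, 0 ≤ ρ.rd2 * sqNorm x.2.2 := fun x =>
    mul_nonneg (by positivity) (sqNorm_nonneg _)
  have hm1 : ∫⁻ x : Inputs T, ENNReal.ofReal (ρ.rd1 * sqNorm x.2.1) ∂(p : Measure (Inputs T))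
      ≤ ENNReal.ofReal (ρ.rd1 * T) := by
    refine lintegral_ofReal_mul_le (by fun_prop) (by positivity) (le_of_eq ?_)
    rw [ENNReal.ofReal_natCast, ← hp.2.1]
    simp_rw [ofReal_sqNorm]
  have hm2 : ∫⁻ x : Inputs T, ENNReal.ofReal (ρ.rd2 * sqNorm x.2.2) ∂(p : Measure (Inputs T))
      ≤ ENNReal.ofReal (ρ.rd2 * T) := by
    refine lintegral_ofReal_mul_le (by fun_prop) (by positivity) (le_of_eq ?_)
    rw [ENNReal.ofReal_natCast, ← hp.2.2]
    simp_rw [ofReal_sqNorm]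
  have hmean : ∫⁻ x, ENNReal.ofReal (W x) ∂(p : Measure (Inputs T))
      ≤ ENNReal.ofReal (ρ.rd1 * T + ρ.rd2 * T + T) := by
    calc _ ≤ ∫⁻ x, (ENNReal.ofReal (ρ.rd1 * sqNorm x.2.1) + ENNReal.ofReal (ρ.rd2 * sqNorm x.2.2)
            + ENNReal.ofReal T) ∂(p : Measure (Inputs T)) := by
          refine lintegral_mono fun x => ?_
          rw [← ENNReal.ofReal_add (h0 x) (h0' x),
            ← ENNReal.ofReal_add (add_nonneg (h0 x) (h0' x)) (by positivity)]
          exact ENNReal.ofReal_le_ofReal (hle x)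
      _ ≤ ENNReal.ofReal (ρ.rd1 * T) + ENNReal.ofReal (ρ.rd2 * T) + ENNReal.ofReal T := by
          rw [lintegral_add_right _ (by fun_prop), lintegral_add_right _ (by fun_prop)]
          gcongr
          simp
      _ = _ := by
          rw [← ENNReal.ofReal_add (by positivity) (by positivity),
            ← ENNReal.ofReal_add (by positivity) (by positivity)]
  refine ⟨integrable_log_one_add hW hW0 (by positivity) hmean,
    (integral_log_one_add_le hW hW0 (by positivity) hmean).trans ?_⟩
  rw [← Real.log_mul (by positivity) (by positivity)]
  refine Real.log_le_log (by positivity) ?_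
  have : (0 : ℝ) ≤ ρ.rd1 := by positivity
  have : (0 : ℝ) ≤ ρ.rd2 := by positivity
  linarith

/-- The orthogonal part is no longer than the block, so the determinant is at most `(1 + rd1
‖x₁‖²)(1 + rd2 ‖x₂‖²)`, whose logarithm is integrable. -/
theorem integrable_log_covDet (hT : 0 < T) (hp : PowerConstraint p) :
    Integrable (fun x => Real.log (covDet ρ.rd1 ρ.rd2 x.2.1 x.2.2)) (p : Measure (Inputs T)) := by
  have hT0 : (0 : ℝ) ≤ T := by positivity
  have h0 : ∀ x : Inputs T, 0 ≤ ρ.rd1 * sqNorm x.2.1 := fun x =>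
    mul_nonneg (by positivity) (sqNorm_nonneg _)
  have h0' : ∀ x : Inputs T, 0 ≤ ρ.rd2 * sqNorm x.2.2 := fun x =>
    mul_nonneg (by positivity) (sqNorm_nonneg _)
  have h1 := (integral_log_received_le ρ hp (W := fun x => ρ.rd1 * sqNorm x.2.1) (by fun_prop) h0
    fun x => by linarith [h0' x]).1
  have h2 := (integral_log_received_le ρ hp (W := fun x => ρ.rd2 * sqNorm x.2.2) (by fun_prop) h0'
    fun x => by linarith [h0 x]).1
  refine (h1.add h2).mono' ?_ (ae_of_all _ fun x => ?_)
  · refine Measurable.aestronglyMeasurable ?_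
    unfold covDet
    fun_prop
  · rw [Real.norm_of_nonneg (Real.log_nonneg (one_le_covDet _ _ _ _))]
    simp only [Pi.add_apply]
    have ha := h0 x
    have hb := h0' x
    rw [← Real.log_mul (by positivity) (by positivity)]
    refine Real.log_le_log (zero_lt_one.trans_le (one_le_covDet _ _ _ _)) ?_
    have hp := mul_le_mul_of_nonneg_left (sqNorm_perp_le (sqNorm_unitDir hT x.2.2) x.2.1)
      (show (0 : ℝ) ≤ ρ.rd1 by positivity)
    have := mul_le_mul_of_nonneg_right hp hb
    unfold covDet
    linarith

/-- Jensen produces `log (1 + W)`, whereas `ψ₁` and `ψ₂` contain `log W`; the exchange costs only a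
constant. -/
theorem integral_log_one_add_le_log_two_add {α : Type*} [MeasurableSpace α] {P : Measure α}
    [IsProbabilityMeasure P] {W : α → ℝ} (hW : ∀ x, 1 ≤ W x)
    (hN : Integrable (fun x => Real.log (1 + W x)) P) (hJ : Integrable (fun x => Real.log (W x)) P) :
    ∫ x, Real.log (1 + W x) ∂P ≤ Real.log 2 + ∫ x, Real.log (W x) ∂P := by
  calc _ ≤ ∫ x, (Real.log 2 + Real.log (W x)) ∂P :=
        integral_mono hN ((integrable_const _).add hJ) fun x => log_one_add_le_log_two_add (hW x)
    _ = _ := by rw [integral_add (integrable_const _) hJ]; simp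

/-- The isotropic reference contributes `T` times the logarithm of the received energy, the
conditional density subtracts `log D`, and together these are `ψ₁`. Only the `δ` part is bounded
through the link strengths. -/
theorem exists_mutualInfo_YD_le (hT : 0 < T) {δ : ℝ} (hδ : 0 < δ) :
    ∃ C : ℝ, ∀ ρ : LinkStrengths, ρ.rd1 ≠ 0 → ρ.rd2 ≠ 0 → ∀ p : ProbabilityMeasure (Inputs T),
      PowerConstraint p → (mutualInfo (fun ω => (XR1 ω, XR2 ω)) YD (networkLaw ρ p) : EReal)
        ≤ ((psi1 T ρ (relayLaw p) + δ * Real.log (1 + ρ.rd1 + ρ.rd2) + C : ℝ) : EReal) := by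
  obtain ⟨K, hK0, hK⟩ := exists_lintegral_isoExponent_le T hδ
  refine ⟨Real.log (4 * Real.pi ^ 2) + T * Real.log 2 + δ * Real.log (1 + T) + K,
    fun ρ hv₁ hv₂ p hp => ?_⟩
  have hT1 : (1 : ℝ) ≤ T := by exact_mod_cast hT
  have hpi := Real.pi_pos
  have h0 : ∀ x : Block T, 0 ≤ ρ.rd1 * sqNorm x := fun x =>
    mul_nonneg (by positivity) (sqNorm_nonneg _)
  have h0' : ∀ x : Block T, 0 ≤ ρ.rd2 * sqNorm x := fun x =>
    mul_nonneg (by positivity) (sqNorm_nonneg _)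
  have hdet := integrable_log_covDet ρ hT hp
  obtain ⟨hN, hNle⟩ := integral_log_received_le ρ hp
    (W := fun x => ρ.rd1 * sqNorm x.2.1 + ρ.rd2 * sqNorm x.2.2 + T) (by fun_prop)
    (fun x => by linarith [h0 x.2.1, h0' x.2.2]) (fun x => le_rfl)
  -- Applied to the energy minus one, since `1 + (W - 1) = W`; nonnegativity uses `T ≥ 1`.
  obtain ⟨hJ, -⟩ := integral_log_received_le ρ hp
    (W := fun x => ρ.rd1 * sqNorm x.2.1 + ρ.rd2 * sqNorm x.2.2 + T - 1) (by fun_prop)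
    (fun x => by linarith [h0 x.2.1, h0' x.2.2]) (fun x => by linarith)
  simp only [add_sub_cancel] at hJ
  have hX : Measurable fun ω : Outcome T => (XR1 ω, XR2 ω) := by
    unfold XR1 XR2; fun_prop
  have hq : (networkLaw ρ p).map (fun ω => (XR1 ω, XR2 ω)) = (p : Measure (Inputs T)).map Prod.snd :=
    map_networkLaw_input ρ p measurable_snd
  have hcm : Measurable fun x : Block T × Block T => Real.log (4 * Real.pi ^ 2)
      - Real.log (covDet ρ.rd1 ρ.rd2 x.1 x.2) := by unfold covDet; fun_prop
  have hBm : Measurable fun x : Block T × Block T => (T + δ) * Real.log (1 +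
      (ρ.rd1 * sqNorm x.1 + ρ.rd2 * sqNorm x.2 + T)) := by fun_prop
  have hlaw : (networkLaw ρ p).map (fun ω => ((XR1 ω, XR2 ω), YD ω))
      = (((networkLaw ρ p).map fun ω => (XR1 ω, XR2 ω)).prod
        (((complexGaussian ρ.rd1).prod (complexGaussian ρ.rd2)).prod (noiseBlockLaw T))).map
        fun a => (a.1, a.2.1.1 • a.1.1 + a.2.1.2 • a.1.2 + a.2.2) :=
    map_networkLaw_channel ρ p measurable_snd (measurePreserving_destState ρ)
      (φ := fun a : (Block T × Block T) × (ℂ × ℂ) × Block T =>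
        a.2.1.1 • a.1.1 + a.2.1.2 • a.1.2 + a.2.2) (by fun_prop)
  refine (mutualInfo_channel_le (l := volume) hX measurable_YD
    (φ := fun a : (Block T × Block T) × (ℂ × ℂ) × Block T =>
        a.2.1.1 • a.1.1 + a.2.1.2 • a.1.2 + a.2.2) (by fun_prop) hlaw
    (c := fun x => Real.log (4 * Real.pi ^ 2) - Real.log (covDet ρ.rd1 ρ.rd2 x.1 x.2)) hcm ?_
    (B := fun x => (T + δ) * Real.log (1 + (ρ.rd1 * sqNorm x.1 + ρ.rd2 * sqNorm x.2 + T)))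
    ?_ (fun x => ?_) (measurable_isoExponent δ) (isoExponent_nonneg hδ)
    (fun x F hF => ?_) (fun x => ?_) hK0 hK).trans ?_
  · rw [hq, integrable_map_measure hcm.aestronglyMeasurable measurable_snd.aemeasurable]
    exact (integrable_const _).sub hdet
  · rw [hq, integrable_map_measure hBm.aestronglyMeasurable measurable_snd.aemeasurable]
    exact hN.const_mul _
  · exact mul_nonneg (by positivity) (Real.log_nonneg (by linarith [h0 x.1, h0' x.2]))
  · rw [lintegral_prod _ (by fun_prop), Real.exp_sub, Real.exp_log (by positivity),
      Real.exp_log (zero_lt_one.trans_le (one_le_covDet _ _ _ _))]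
    exact lintegral_two_gains_noise_le hT hv₁ hv₂ x.1 x.2 hF
  · have h1 := h0 x.1
    have h2 := h0' x.2
    exact lintegral_isoExponent_le (by fun_prop) hδ (by positivity)
      (lintegral_sqNorm_two_gains ρ.rd1 ρ.rd2 x.1 x.2).le
  · rw [EReal.coe_le_coe_iff, hq,
      integral_map measurable_snd.aemeasurable hcm.aestronglyMeasurable,
      integral_map measurable_snd.aemeasurable hBm.aestronglyMeasurable,
      integral_sub (integrable_const _) hdet, integral_const_mul, psi1,
      integral_relayLaw p (by fun_prop), integral_relayLaw p (by unfold logDet; fun_prop)]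
    simp only [integral_const, probReal_univ, smul_eq_mul, one_mul, logDet_relayCoords hT]
    have hJ' : ∀ x : Inputs T, ρ.rd2 * ‖(relayCoords x).1‖ ^ 2 + ρ.rd1 * ‖(relayCoords x).2.1‖ ^ 2
        + ρ.rd1 * ‖(relayCoords x).2.2‖ ^ 2 + T
        = ρ.rd1 * sqNorm x.2.1 + ρ.rd2 * sqNorm x.2.2 + T := fun x => by
      rw [sqNorm_eq_relayCoords hT x, ← norm_relayCoords_fst_sq x]; ring
    simp only [hJ']
    have hNJ := integral_log_one_add_le_log_two_add (P := (p : Measure (Inputs T)))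
      (W := fun x => ρ.rd1 * sqNorm x.2.1 + ρ.rd2 * sqNorm x.2.2 + T)
      (fun x => by linarith [h0 x.2.1, h0' x.2.2]) hN hJ
    have h1 := mul_le_mul_of_nonneg_left hNJ (show (0 : ℝ) ≤ T by linarith)
    have h2 := mul_le_mul_of_nonneg_left hNle hδ.le
    linarith

/-- The reference is aligned with the known block of relay 2. That block then affects only the
single parallel dimension, and the `T - 1` orthogonal dimensions see relay 1 and noise alone, which
is the shape of `ψ₂`. -/
theorem exists_condMutualInfo_YD_le (hT : 2 ≤ T) {δ : ℝ} (hδ : 0 < δ) :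
    ∃ C : ℝ, ∀ ρ : LinkStrengths, ρ.rd1 ≠ 0 → ρ.rd2 ≠ 0 → ∀ p : ProbabilityMeasure (Inputs T),
      PowerConstraint p → (condMutualInfo XR1 YD XR2 (networkLaw ρ p) : EReal)
        ≤ ((psi2 T ρ (relayLaw p) + 2 * δ * Real.log (1 + ρ.rd1 + ρ.rd2) + C : ℝ) : EReal) := by
  have hT0 : 0 < T := by omega
  obtain ⟨K, hK0, hK⟩ := exists_lintegral_dirExponent_le hT0 hδ
  refine ⟨Real.log (4 * Real.pi ^ 2) + T * Real.log 2 + 2 * δ * Real.log (1 + T) + K,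
    fun ρ hv₁ hv₂ p hp => ?_⟩
  have hT2 : (2 : ℝ) ≤ T := by exact_mod_cast hT
  have hpi := Real.pi_pos
  have hu : ∀ z : Block T, sqNorm (unitDir z) = 1 := sqNorm_unitDir hT0
  have h0 : ∀ x : Block T, 0 ≤ ρ.rd1 * sqNorm x := fun x =>
    mul_nonneg (by positivity) (sqNorm_nonneg _)
  have h0' : ∀ x : Block T, 0 ≤ ρ.rd2 * sqNorm x := fun x =>
    mul_nonneg (by positivity) (sqNorm_nonneg _)
  have hh0 : ∀ u x : Block T, 0 ≤ ρ.rd1 * ‖herm u x‖ ^ 2 := fun u x => by positivity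
  have hsplit : ∀ z x : Block T, ρ.rd1 * sqNorm x
      = ρ.rd1 * ‖herm (unitDir z) x‖ ^ 2 + ρ.rd1 * sqNorm (perp (unitDir z) x) := fun z x => by
    rw [sqNorm_eq_herm_add_perp (hu z) x, mul_add]
  have hdet := integrable_log_covDet ρ hT0 hp
  -- `W₁` and `W₂` are the mean energies of the output along and orthogonal to the block of relay 2,
  -- kept opaque to rewriting.
  obtain ⟨W₁, hW₁⟩ : ∃ W : Block T × Block T → ℝ, W = fun x =>
    ρ.rd1 * ‖herm (unitDir x.1) x.2‖ ^ 2 + ρ.rd2 * sqNorm x.1 + 1 := ⟨_, rfl⟩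
  obtain ⟨W₂, hW₂⟩ : ∃ W : Block T × Block T → ℝ, W = fun x =>
    ρ.rd1 * sqNorm (perp (unitDir x.1) x.2) + ((T : ℝ) - 1) := ⟨_, rfl⟩
  have hW₁m : Measurable W₁ := by rw [hW₁]; fun_prop
  have hW₂m : Measurable W₂ := by rw [hW₂]; fun_prop
  have hW₁1 : ∀ x, 1 ≤ W₁ x := fun x => by
    simp only [hW₁]; linarith [hh0 (unitDir x.1) x.2, h0' x.1]
  -- With a zero orthogonal signal this says `T - 1 ≥ 1`, which is where `T ≥ 2` enters.
  have hW₂1 : ∀ x, 1 ≤ W₂ x := fun x => by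
    simp only [hW₂]; linarith [h0 (perp (unitDir x.1) x.2)]
  have hW₁le : ∀ x : Inputs T, W₁ (x.2.2, x.2.1)
      ≤ ρ.rd1 * sqNorm x.2.1 + ρ.rd2 * sqNorm x.2.2 + T := fun x => by
    simp only [hW₁]; linarith [hsplit x.2.2 x.2.1, h0 (perp (unitDir x.2.2) x.2.1)]
  have hW₂le : ∀ x : Inputs T, W₂ (x.2.2, x.2.1)
      ≤ ρ.rd1 * sqNorm x.2.1 + ρ.rd2 * sqNorm x.2.2 + T := fun x => by
    simp only [hW₂]; linarith [hsplit x.2.2 x.2.1, hh0 (unitDir x.2.2) x.2.1, h0' x.2.2]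
  obtain ⟨hN₁, hN₁le⟩ := integral_log_received_le ρ hp (W := fun x => W₁ (x.2.2, x.2.1))
    (by fun_prop) (fun x => zero_le_one.trans (hW₁1 _)) hW₁le
  obtain ⟨hN₂, hN₂le⟩ := integral_log_received_le ρ hp (W := fun x => W₂ (x.2.2, x.2.1))
    (by fun_prop) (fun x => zero_le_one.trans (hW₂1 _)) hW₂le
  obtain ⟨hJ₁, -⟩ := integral_log_received_le ρ hp (W := fun x => W₁ (x.2.2, x.2.1) - 1)
    (by fun_prop) (fun x => by linarith [hW₁1 (x.2.2, x.2.1)]) fun x => by linarith [hW₁le x]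
  obtain ⟨hJ₂, -⟩ := integral_log_received_le ρ hp (W := fun x => W₂ (x.2.2, x.2.1) - 1)
    (by fun_prop) (fun x => by linarith [hW₂1 (x.2.2, x.2.1)]) fun x => by linarith [hW₂le x]
  simp only [add_sub_cancel] at hJ₁ hJ₂
  have hX : Measurable (XR1 : Outcome T → Block T) := by unfold XR1; fun_prop
  have hZ : Measurable (XR2 : Outcome T → Block T) := by unfold XR2; fun_prop
  have hπ : Measurable fun x : Inputs T => (x.2.2, x.2.1) := by fun_prop
  have hq : (networkLaw ρ p).map (fun ω => (XR2 ω, XR1 ω)) = (p : Measure (Inputs T)).map fun x => (x.2.2, x.2.1) :=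
    map_networkLaw_input ρ p hπ
  have hcm : Measurable fun x : Block T × Block T => Real.log (4 * Real.pi ^ 2)
      - Real.log (covDet ρ.rd1 ρ.rd2 x.2 x.1) := by unfold covDet; fun_prop
  have hBm : Measurable fun x : Block T × Block T => (1 + δ) * Real.log (1 + W₁ x)
      + ((T : ℝ) - 1 + δ) * Real.log (1 + W₂ x) := by fun_prop
  have hBi : Integrable (fun x : Inputs T => (1 + δ) * Real.log (1 + W₁ (x.2.2, x.2.1))
      + ((T : ℝ) - 1 + δ) * Real.log (1 + W₂ (x.2.2, x.2.1))) (p : Measure (Inputs T)) :=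
    (hN₁.const_mul _).add (hN₂.const_mul _)
  have hTδ : 0 ≤ (T : ℝ) - 1 + δ := by linarith
  have hl₁ : ∀ x, 0 ≤ Real.log (1 + W₁ x) := fun x => Real.log_nonneg (by linarith [hW₁1 x])
  have hl₂ : ∀ x, 0 ≤ Real.log (1 + W₂ x) := fun x => Real.log_nonneg (by linarith [hW₂1 x])
  have hlaw : (networkLaw ρ p).map (fun ω => ((XR2 ω, XR1 ω), YD ω))
      = (((networkLaw ρ p).map fun ω => (XR2 ω, XR1 ω)).prod
        (((complexGaussian ρ.rd1).prod (complexGaussian ρ.rd2)).prod (noiseBlockLaw T))).map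
        fun a => (a.1, a.2.1.1 • a.1.2 + a.2.1.2 • a.1.1 + a.2.2) :=
    map_networkLaw_channel ρ p hπ (measurePreserving_destState ρ)
      (φ := fun a : (Block T × Block T) × (ℂ × ℂ) × Block T =>
        a.2.1.1 • a.1.2 + a.2.1.2 • a.1.1 + a.2.2) (by fun_prop)
  have hci : Integrable (fun x : Block T × Block T => Real.log (4 * Real.pi ^ 2)
      - Real.log (covDet ρ.rd1 ρ.rd2 x.2 x.1))
      ((networkLaw ρ p).map fun ω => (XR2 ω, XR1 ω)) := by
    rw [hq, integrable_map_measure hcm.aestronglyMeasurable hπ.aemeasurable]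
    exact (integrable_const _).sub hdet
  have hBi' : Integrable (fun x : Block T × Block T => (1 + δ) * Real.log (1 + W₁ x)
      + ((T : ℝ) - 1 + δ) * Real.log (1 + W₂ x))
      ((networkLaw ρ p).map fun ω => (XR2 ω, XR1 ω)) := by
    rw [hq, integrable_map_measure hBm.aestronglyMeasurable hπ.aemeasurable]
    exact hBi
  have hB0 : ∀ x : Block T × Block T, 0 ≤ (1 + δ) * Real.log (1 + W₁ x)
      + ((T : ℝ) - 1 + δ) * Real.log (1 + W₂ x) := fun x =>
    add_nonneg (mul_nonneg (by positivity) (hl₁ x)) (mul_nonneg hTδ (hl₂ x))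
  have hA : Measurable fun a : Block T × Block T => dirExponent δ (unitDir a.1) a.2 := by fun_prop
  have hdens : ∀ x : Block T × Block T, ∀ F : Block T → ℝ≥0∞, Measurable F →
      ∫⁻ g : (ℂ × ℂ) × Block T, F (g.1.1 • x.2 + g.1.2 • x.1 + g.2)
        ∂((complexGaussian ρ.rd1).prod (complexGaussian ρ.rd2)).prod (noiseBlockLaw T)
      ≤ ENNReal.ofReal (Real.exp (Real.log (4 * Real.pi ^ 2)
        - Real.log (covDet ρ.rd1 ρ.rd2 x.2 x.1))) * ∫⁻ y, F y := fun x F hF => by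
    rw [lintegral_prod _ (by fun_prop), Real.exp_sub, Real.exp_log (by positivity),
      Real.exp_log (zero_lt_one.trans_le (one_le_covDet _ _ _ _))]
    exact lintegral_two_gains_noise_le hT0 hv₁ hv₂ x.2 x.1 hF
  have hAB : ∀ x : Block T × Block T,
      ∫⁻ g : (ℂ × ℂ) × Block T,
        ENNReal.ofReal (dirExponent δ (unitDir x.1) (g.1.1 • x.2 + g.1.2 • x.1 + g.2))
        ∂((complexGaussian ρ.rd1).prod (complexGaussian ρ.rd2)).prod (noiseBlockLaw T)
      ≤ ENNReal.ofReal ((1 + δ) * Real.log (1 + W₁ x)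
        + ((T : ℝ) - 1 + δ) * Real.log (1 + W₂ x)) := fun x => by
    have hpar := lintegral_norm_herm_sq_two_gains ρ.rd1 ρ.rd2 x.2 x.1 (unitDir x.1)
    have hperp := lintegral_sqNorm_perp_two_gains ρ.rd1 ρ.rd2 x.2 x.1 (hu x.1)
    rw [hu, herm_unitDir_self hT0, norm_ofReal_sqrt_sq (sqNorm_nonneg _)] at hpar
    rw [perp_unitDir_self hT0, show sqNorm (0 : Block T) = 0 by simp [sqNorm], mul_zero,
      add_zero] at hperp
    replace hpar := hpar.trans (congrArg ENNReal.ofReal (congrFun hW₁ x).symm)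
    replace hperp := hperp.trans (congrArg ENNReal.ofReal (congrFun hW₂ x).symm)
    have hA₁ := lintegral_ofReal_mul_le (by fun_prop) (show 0 ≤ 1 + δ by linarith)
      (lintegral_log_one_add_le (by fun_prop) (fun _ => sq_nonneg _)
        (zero_le_one.trans (hW₁1 x)) hpar.le)
    have hA₂ := lintegral_ofReal_mul_le (by fun_prop) hTδ
      (lintegral_log_one_add_le (by fun_prop) (fun _ => sqNorm_nonneg _)
        (zero_le_one.trans (hW₂1 x)) hperp.le)
    rw [ENNReal.ofReal_add (mul_nonneg (by positivity) (hl₁ x)) (mul_nonneg hTδ (hl₂ x))]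
    refine le_trans ?_ (add_le_add hA₁ hA₂)
    rw [← lintegral_add_left (by fun_prop)]
    exact lintegral_mono fun s => ENNReal.ofReal_add_le
  have hKz : ∀ z : Block T, ∫⁻ y : Block T,
      ENNReal.ofReal (Real.exp (-dirExponent δ (unitDir z) y)) ≤ ENNReal.ofReal K := fun z =>
    hK (unitDir z) (hu z)
  refine (condMutualInfo_channel_le (l := volume) hX measurable_YD hZ
    (φ := fun a : (Block T × Block T) × (ℂ × ℂ) × Block T =>
        a.2.1.1 • a.1.2 + a.2.1.2 • a.1.1 + a.2.2) (by fun_prop) hlaw hcm hci hBi' hB0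
    (A := fun a => dirExponent δ (unitDir a.1) a.2) hA
    (fun a => dirExponent_nonneg hT0 hδ _ _) hdens hAB hK0 hKz).trans ?_
  · rw [EReal.coe_le_coe_iff, hq,
      integral_map hπ.aemeasurable hcm.aestronglyMeasurable,
      integral_map hπ.aemeasurable hBm.aestronglyMeasurable,
      integral_sub (integrable_const _) hdet, integral_add (hN₁.const_mul _) (hN₂.const_mul _),
      integral_const_mul, integral_const_mul, psi2, integral_relayLaw p (by fun_prop),
      integral_relayLaw p (by fun_prop), integral_relayLaw p (by unfold logDet; fun_prop)]
    simp only [integral_const, probReal_univ, smul_eq_mul, one_mul, logDet_relayCoords hT0]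
    have hJ₁' : ∀ x : Inputs T, ρ.rd2 * ‖(relayCoords x).1‖ ^ 2 + ρ.rd1 * ‖(relayCoords x).2.1‖ ^ 2
        + 1 = W₁ (x.2.2, x.2.1) := fun x => by
      rw [norm_relayCoords_fst_sq x]; simp only [hW₁, relayCoords]; ring
    have hJ₂' : ∀ x : Inputs T, ρ.rd1 * ‖(relayCoords x).2.2‖ ^ 2 + ((T : ℝ) - 1)
        = W₂ (x.2.2, x.2.1) := fun x => by
      rw [norm_relayCoords_snd_snd_sq x, hW₂]
    simp only [hJ₁', hJ₂']
    have h1 := integral_log_one_add_le_log_two_add (fun x : Inputs T => hW₁1 (x.2.2, x.2.1)) hN₁ hJ₁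
    have h2 := mul_le_mul_of_nonneg_left
      (integral_log_one_add_le_log_two_add (fun x : Inputs T => hW₂1 (x.2.2, x.2.1)) hN₂ hJ₂)
      (show (0 : ℝ) ≤ (T : ℝ) - 1 by linarith)
    have h3 := mul_le_mul_of_nonneg_left hN₁le hδ.le
    have h4 := mul_le_mul_of_nonneg_left hN₂le hδ.le
    linarith

end MultipleAccess

end DiamondNetwork

namespace DiamondNetwork

/-! ### Assembling the cuts. -/

section CutSet

variable {T : ℕ}

theorem exists_powerConstraint (T : ℕ) : ∃ p : ProbabilityMeasure (Inputs T), PowerConstraint p := by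
  refine ⟨⟨Measure.dirac (fun _ => 1, fun _ => 1, fun _ => 1), inferInstance⟩, ?_⟩
  have h : ∀ f : Inputs T → Block T, Measurable f →
      ∫⁻ x, energy (f x) ∂(Measure.dirac (fun _ => 1, fun _ => 1, fun _ => 1) : Measure (Inputs T))
        = energy (f (fun _ => 1, fun _ => 1, fun _ => 1)) := fun f hf =>
    lintegral_dirac' _ (by unfold energy; fun_prop)
  refine ⟨(h _ measurable_fst).trans ?_, (h _ (by fun_prop)).trans ?_, (h _ (by fun_prop)).trans ?_⟩
  all_goals simp [energy]

/-- A bound on every feasible cut-set value bounds their supremum. -/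
theorem coe_cutSetTC_le {ρ : LinkStrengths} {R : EReal}
    (h : ∀ p : ProbabilityMeasure (Inputs T), PowerConstraint p →
      ((min
        (min
          (mutualInfo XS (fun ω => (YR1 ω, YR2 ω)) (networkLaw ρ p))
          (mutualInfo XS YR2 (networkLaw ρ p) + condMutualInfo XR1 YD XR2 (networkLaw ρ p)))
        (min
          (mutualInfo XS YR1 (networkLaw ρ p) + condMutualInfo XR2 YD XR1 (networkLaw ρ p))
          (mutualInfo (fun ω => (XR1 ω, XR2 ω)) YD (networkLaw ρ p))) : ℝ≥0∞) : EReal) ≤ R) :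
    (cutSetTC T ρ : EReal) ≤ R := by
  obtain ⟨p₀, hp₀⟩ := exists_powerConstraint T
  -- A feasible law exists, so `R` is nonnegative and the supremum can be bounded in `ℝ≥0∞`; over an
  -- empty family `R` could be negative.
  have hR : 0 ≤ R := (EReal.coe_ennreal_nonneg _).trans (h p₀ hp₀)
  rw [← EReal.coe_toENNReal hR, EReal.coe_ennreal_le_coe_ennreal_iff]
  refine iSup₂_le fun p hp => ?_
  rw [← EReal.coe_ennreal_le_coe_ennreal_iff, EReal.coe_toENNReal hR]
  exact h p hp

/-- The cut-set bound at fixed link strengths, up to an additive constant and an arbitrarily small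
multiple of the logarithms of the link strengths. -/
theorem exists_cutSetTC_le (hT : 2 ≤ T) {δ : ℝ} (hδ : 0 < δ) :
    ∃ C : ℝ, ∀ ρ : LinkStrengths, 1 ≤ ρ.sr2 → ρ.sr2 ≤ ρ.sr1 → ρ.rd1 ≠ 0 → ρ.rd2 ≠ 0 →
      (cutSetTC T ρ : EReal)
        ≤ min ((((T : ℝ) - 1) * Real.log ρ.sr1 : ℝ) : EReal) (valueP1 T ρ)
          + ((2 * δ * (Real.log ρ.sr1 + Real.log (1 + ρ.rd1 + ρ.rd2)) + C : ℝ) : EReal) := by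
  have hT0 : 0 < T := by omega
  obtain ⟨C₁, h₁⟩ := exists_mutualInfo_YR1_YR2_le hT0 hδ
  obtain ⟨C₂, h₂⟩ := exists_mutualInfo_YR2_le hT0 hδ
  obtain ⟨C₃, h₃⟩ := exists_condMutualInfo_YD_le hT hδ
  obtain ⟨C₄, h₄⟩ := exists_mutualInfo_YD_le hT0 hδ
  -- The sum of absolute values dominates `C₁`, `C₄` and `C₂ + C₃`, the constants of the three cuts
  -- used.
  refine ⟨|C₁| + |C₂| + |C₃| + |C₄|, fun ρ hsr2 hsr hrd1 hrd2 => coe_cutSetTC_le fun p hp => ?_⟩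
  have hC₁ := le_abs_self C₁
  have hC₂ := le_abs_self C₂
  have hC₃ := le_abs_self C₃
  have hC₄ := le_abs_self C₄
  have a₁ := abs_nonneg C₁
  have a₂ := abs_nonneg C₂
  have a₃ := abs_nonneg C₃
  have a₄ := abs_nonneg C₄
  have hsr2' : (1 : ℝ) ≤ ρ.sr2 := by exact_mod_cast hsr2
  have hsr' : (ρ.sr2 : ℝ) ≤ ρ.sr1 := by exact_mod_cast hsr
  have l2 : 0 ≤ δ * Real.log ρ.sr2 := mul_nonneg hδ.le (Real.log_nonneg hsr2')
  have l1 : δ * Real.log ρ.sr2 ≤ δ * Real.log ρ.sr1 :=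
    mul_le_mul_of_nonneg_left (Real.log_le_log (by linarith) hsr') hδ.le
  have l3 : 0 ≤ δ * Real.log (1 + ρ.rd1 + ρ.rd2) := mul_nonneg hδ.le (Real.log_nonneg (by
    have : (0 : ℝ) ≤ ρ.rd1 := ρ.rd1.coe_nonneg
    have : (0 : ℝ) ≤ ρ.rd2 := ρ.rd2.coe_nonneg
    linarith))
  rw [← min_add_add_right]
  refine le_min ?_ ?_
  · refine (EReal.coe_ennreal_le_coe_ennreal_iff.2
      ((min_le_left _ _).trans (min_le_left _ _))).trans ((h₁ ρ hsr2 hsr p hp).trans ?_)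
    rw [← EReal.coe_add, EReal.coe_le_coe_iff]
    linarith
  -- Both destination cuts are compared with `𝒫₁` at the same law, so the minimum of `ψ₁` and the
  -- second expression is bounded by a single feasible value.
  · have hP : ((min (psi1 T ρ (relayLaw p))
        (((T : ℝ) - 1) * Real.log ρ.sr2 + psi2 T ρ (relayLaw p)) : ℝ) : EReal) ≤ valueP1 T ρ :=
      le_iSup₂_of_le (relayLaw p) (feasible_relayLaw hT0 hp) le_rfl
    refine le_trans ?_ (add_le_add_left hP _)
    rw [← EReal.coe_add, ← min_add_add_right, EReal.coe_strictMono.monotone.map_min]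
    refine le_min ?_ ?_
    · refine (EReal.coe_ennreal_le_coe_ennreal_iff.2
        ((min_le_right _ _).trans (min_le_right _ _))).trans ((h₄ ρ hrd1 hrd2 p hp).trans ?_)
      rw [EReal.coe_le_coe_iff]
      linarith
    · refine (EReal.coe_ennreal_le_coe_ennreal_iff.2
        ((min_le_left _ _).trans (min_le_right _ _))).trans ?_
      rw [EReal.coe_ennreal_add]
      refine (add_le_add (h₂ ρ hsr2 p hp) (h₃ ρ hrd1 hrd2 p hp)).trans ?_
      rw [← EReal.coe_add, EReal.coe_le_coe_iff]
      linarith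

theorem log_one_add_rpow_add_rpow_le {Γ a b s : ℝ} (hΓ : 0 ≤ Γ) (ha : a ≤ Γ) (hb : b ≤ Γ)
    (hs : 1 ≤ s) : Real.log (1 + s ^ a + s ^ b) ≤ Real.log 3 + Γ * Real.log s := by
  have hs0 : 0 < s := by linarith
  rw [← Real.log_rpow hs0, ← Real.log_mul (by norm_num) (Real.rpow_pos_of_pos hs0 _).ne']
  refine Real.log_le_log (by positivity) ?_
  linarith [Real.one_le_rpow hs hΓ, Real.rpow_le_rpow_of_exponent_le hs ha,
    Real.rpow_le_rpow_of_exponent_le hs hb]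

end CutSet

end DiamondNetwork

/-! ### Passage to large SNR. -/

theorem mainTheorem5 (T : ℕ) (hT : 2 ≤ T) (γsr1 γsr2 γrd1 γrd2 : ℝ)
    (hsr2 : 0 ≤ γsr2) (hsr : γsr2 ≤ γsr1) :
    DiamondNetwork.DotLE
      (fun snr => ((DiamondNetwork.cutSetTC T
        (DiamondNetwork.strengthsAt γsr1 γsr2 γrd1 γrd2 snr) : ENNReal) : EReal))
      (fun snr => min
        (((((T : ℝ) - 1) *
          Real.log (DiamondNetwork.strengthsAt γsr1 γsr2 γrd1 γrd2 snr).sr1 : ℝ)) : EReal)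
        (DiamondNetwork.valueP1 T
          (DiamondNetwork.strengthsAt γsr1 γsr2 γrd1 γrd2 snr))) := by
  intro ε hε
  -- The destination exponents may have either sign; a nonnegative `Γ` above both also dominates the
  -- constant `1` in the logarithm.
  set Γ := |γrd1| + |γrd2|
  have hΓ : 0 ≤ Γ := by positivity
  have hγ : 0 ≤ γsr1 := hsr2.trans hsr
  obtain ⟨δ, hδ, hδε⟩ : ∃ δ : ℝ, 0 < δ ∧ 2 * δ * (γsr1 + Γ) ≤ ε / 2 := by
    -- Half of `ε` pays for the slack proportional to `δ`; the `+ 1` keeps the denominator positive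
    -- when all exponents vanish. The other half absorbs the constants once `log SNR` is large.
    refine ⟨ε / (4 * (γsr1 + Γ + 1)), by positivity, ?_⟩
    have h : 2 * (ε / (4 * (γsr1 + Γ + 1))) * (γsr1 + Γ + 1) = ε / 2 := by field_simp; ring
    have h' : 0 ≤ ε / (4 * (γsr1 + Γ + 1)) := by positivity
    linarith
  obtain ⟨C, hC⟩ := DiamondNetwork.exists_cutSetTC_le hT hδ
  filter_upwards [eventually_ge_atTop 1, Real.tendsto_log_atTop.eventually_ge_atTop
    ((2 * δ * Real.log 3 + C) / (ε / 2))] with s hs hlog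
  have hs0 : 0 < s := by linarith
  rw [div_le_iff₀ (by linarith)] at hlog
  have hpos : ∀ γ : ℝ, (s ^ γ).toNNReal ≠ 0 := fun γ => by
    simpa using Real.rpow_pos_of_pos hs0 γ
  have hcoe : ∀ γ : ℝ, ((s ^ γ).toNNReal : ℝ) = s ^ γ := fun γ =>
    Real.coe_toNNReal _ (Real.rpow_nonneg hs0.le _)
  have h := hC (DiamondNetwork.strengthsAt γsr1 γsr2 γrd1 γrd2 s)
    (by simpa [DiamondNetwork.strengthsAt] using Real.one_le_rpow hs hsr2)
    (Real.toNNReal_le_toNNReal (Real.rpow_le_rpow_of_exponent_le hs hsr)) (hpos _) (hpos _)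
  refine h.trans (add_le_add_right (EReal.coe_le_coe_iff.2 ?_) _)
  simp only [DiamondNetwork.strengthsAt, hcoe, Real.log_rpow hs0]
  have h1 := DiamondNetwork.log_one_add_rpow_add_rpow_le hΓ
    ((le_abs_self γrd1).trans (le_add_of_nonneg_right (abs_nonneg γrd2)))
    ((le_abs_self γrd2).trans (le_add_of_nonneg_left (abs_nonneg γrd1))) hs
  have h2 := mul_le_mul_of_nonneg_left h1 (show 0 ≤ 2 * δ by linarith)
  have h3 := mul_le_mul_of_nonneg_right hδε (Real.log_nonneg hs)
  linarith
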